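/- Let $p$ be a prime, $q=p^e$ with $e\ge 1$, let $n\ge 1$ be odd and $m=(q^n+1)/(q+1)$. Let $\mathcal C_n=\mathbb F_{q^{2n}}(x,y,z)$ be the generalized Giulietti--Korchmáros function field over $\mathbb F_{q^{2n}}$, defined by $$x^q+x=y^{q+1},\qquad z^m=y^{q^2}-y ,$$ which contains the Hermitian function field $\mathcal H=\mathbb F_{q^2}(x,y)$ over $\mathbb F_{q^2}$. Let $Q_\infty$ be the unique pole of $z$ in $\mathcal C_n$ and $P_\infty$ the unique pole of $x$ in $\mathcal H$. Let $B(Q_\infty)$ be the stabilizer of $Q_\infty$ in $\mathrm{Aut}(\mathcal C_n/\mathbb F_{q^{2n}})$ and $A(P_\infty)$ the stabilizer of $P_\infty$ in $\mathrm{Aut}(\mathcal H/\mathbb F_{q^2})$. For $\alpha,\beta\in\mathbb F_{q^2}$ with $\alpha^q+\alpha=\beta^{q+1}$, let $P_{\alpha\beta}$ be the place of $\mathbb F_{q^{2n}}(x,y)$ at which $x$ and $y$ take the values $\alpha$ and $\beta$, and let $Q_{\alpha\beta}$ be the unique place of $\mathcal C_n$ lying over $P_{\alpha\beta}$. Every $g\in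 B(Q_\infty)$ restricts to an automorphism $\pi(g)\in A(P_\infty)$ of $\mathcal H$. Let $\mathrm{ord}(\pi(g))$ be its order, and let $N(g)$ be the number of places $Q_{\alpha\beta}$ with $g(Q_{\alpha\beta})=Q_{\alpha\beta}$. Then $$N(g)=\begin{cases}0 & \text{if } p\mid \mathrm{ord}(\pi(g)),\\ q^3 & \text{if } \pi(g)=\mathrm{id},\\ q & \text{if } \pi(g)\ne\mathrm{id} \text{ and } \mathrm{ord}(\pi(g))\mid q+1,\\ 1 & \text{otherwise.}\end{cases}$$ -/

import Mathlib

open scoped Pointwise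

/-- `P` is (the valuation ring of) a place of the function field `F / k`: a valuation ring `P` of
`F` with `k ⊆ P ⊊ F`. Automorphisms act by `σ • P = σ(P)`. -/
def IsPlace (k : Type*) {F : Type*} [Field k] [Field F] [Algebra k F]
    (P : ValuationSubring F) : Prop :=
  (∀ c : k, algebraMap k F c ∈ P) ∧ P ≠ ⊤

/-- `P` is a place of `F / k` and a pole of `f`. -/
def IsPoleOf (k : Type*) {F : Type*} [Field k] [Field F] [Algebra k F]
    (P : ValuationSubring F) (f : F) : Prop :=
  IsPlace k P ∧ f ∉ P

/-- The function `f` takes the value `a ∈ k` at `P`: `f - a` lies in the maximal ideal of `P`. -/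
def HasValueAt {k F : Type*} [Field k] [Field F] [Algebra k F]
    (P : ValuationSubring F) (f : F) (a : k) : Prop :=
  f - algebraMap k F a ∈ P.nonunits

/-- The subfield `𝔽_{q²}` of a field `k` containing `𝔽_{q²}`. If `q` is a power of the
characteristic, the generating set is itself a field, see `mem_Fq2`. -/
def Fq2 (k : Type*) [Field k] (q : ℕ) : Subfield k :=
  Subfield.closure {a : k | a ^ q ^ 2 = a}

theorem mem_Fq2 {k : Type*} [Field k] {p e : ℕ} [hp : Fact p.Prime] [CharP k p] (a : k) :
    a ∈ Fq2 k (p ^ e) ↔ a ^ (p ^ e) ^ 2 = a := by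
  constructor
  · intro h
    have hle : Fq2 k (p ^ e) ≤
        (iterateFrobenius k p (e * 2)).eqLocusField (RingHom.id k) := by
      refine Subfield.closure_le.2 ?_
      intro b hb
      have hb' : b ^ (p ^ e) ^ 2 = b := hb
      change iterateFrobenius k p (e * 2) b = b
      rw [iterateFrobenius_def, pow_mul]
      exact hb'
    have h2 : iterateFrobenius k p (e * 2) a = a := hle h
    rwa [iterateFrobenius_def, pow_mul] at h2
  · intro h
    exact Subfield.subset_closure h

/-- `C / k` is the generalized Giulietti--Korchmáros function field, `C = k(x, y, z)` with
`x^q + x = y^(q+1)` and `z^m = y^(q²) - y`, `m = (q^n + 1) / (q + 1)`. Being a function field,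
it is not algebraic over `k`; equivalently `y` is transcendental. Then `C` has degree `q * m`
over `k(y)`, so that `(C, x, y, z)` is determined up to isomorphism. -/
structure IsGGK (k : Type*) {C : Type*} [Field k] [Field C] [Algebra k C]
    (q n : ℕ) (x y z : C) : Prop where
  adjoin_eq_top : IntermediateField.adjoin k {x, y, z} = ⊤
  transcendental_y : Transcendental k y
  eq_xy : x ^ q + x = y ^ (q + 1)
  eq_yz : z ^ ((q ^ n + 1) / (q + 1)) = y ^ q ^ 2 - y

/-- The Hermitian function field `𝔽_{q²}(x, y)` over `𝔽_{q²}`, inside `C`. -/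
abbrev Herm (k : Type*) {C : Type*} [Field k] [Field C] [Algebra k C]
    (q : ℕ) (x y : C) : IntermediateField (Fq2 k q) C :=
  IntermediateField.adjoin (Fq2 k q) {x, y}

/-- The function `x` as an element of the Hermitian function field. -/
def hermX (k : Type*) {C : Type*} [Field k] [Field C] [Algebra k C]
    (q : ℕ) (x y : C) : Herm k q x y :=
  ⟨x, IntermediateField.subset_adjoin _ _ (Set.mem_insert x {y})⟩

/-- The constant field extension `k(x, y)` of the Hermitian function field, inside `C`. -/
abbrev HermK (k : Type*) {C : Type*} [Field k] [Field C] [Algebra k C]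
    (x y : C) : IntermediateField k C :=
  IntermediateField.adjoin k {x, y}

/-- `P` is the place `P_{αβ}` of `k(x, y)`, that is, the place with `x(P) = α`, `y(P) = β`. -/
def IsPab {k C : Type*} [Field k] [Field C] [Algebra k C] (x y : C) (α β : k)
    (P : ValuationSubring (HermK k x y)) : Prop :=
  IsPlace k P ∧
    HasValueAt P ⟨x, IntermediateField.subset_adjoin _ _ (Set.mem_insert x {y})⟩ α ∧
    HasValueAt P ⟨y, IntermediateField.subset_adjoin _ _ (Set.mem_insert_of_mem x rfl)⟩ β

/-- `Q` is the place `Q_{αβ}` of `C`, that is, the place of `C` lying over `P_{αβ}`. -/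
def IsQab {k C : Type*} [Field k] [Field C] [Algebra k C] (x y : C) (α β : k)
    (Q : ValuationSubring C) : Prop :=
  IsPlace k Q ∧ IsPab x y α β (Q.comap (algebraMap (HermK k x y) C))

/-- The set of the places `Q_{αβ}`, for `α, β ∈ 𝔽_{q²}` with `α^q + α = β^(q+1)`. -/
def placesQ (k : Type*) {C : Type*} [Field k] [Field C] [Algebra k C]
    (q : ℕ) (x y : C) : Set (ValuationSubring C) :=
  {Q | ∃ α ∈ Fq2 k q, ∃ β ∈ Fq2 k q, α ^ q + α = β ^ (q + 1) ∧ IsQab x y α β Q}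

/-- `N(g)`, the number of places `Q_{αβ}` fixed by `g`. -/
noncomputable def numFixed {k C : Type*} [Field k] [Field C] [Algebra k C]
    (q : ℕ) (x y : C) (g : C ≃ₐ[k] C) : ℕ∞ :=
  {Q | Q ∈ placesQ k q x y ∧ g • Q = Q}.encard

/-- `h` is the restriction of the automorphism `g` of `C` to the Hermitian function field. Such an
`h` is unique if it exists. -/
def IsRestriction {k C : Type*} [Field k] [Field C] [Algebra k C] {q : ℕ} {x y : C}
    (g : C ≃ₐ[k] C) (h : Herm k q x y ≃ₐ[Fq2 k q] Herm k q x y) : Prop :=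
  ∀ f : Herm k q x y, ((h f : Herm k q x y) : C) = g (f : C)

/-- Generalized Giulietti--Korchmáros function fields exist. -/
theorem exists_isGGK (k : Type) [Field k] (q n : ℕ) (hq : 2 ≤ q) (hn : 0 < n) :
    ∃ (C : Type) (_ : Field C) (_ : Algebra k C) (x y z : C), IsGGK k q n x y z := by
  let Ω := AlgebraicClosure (RatFunc k)
  let y : Ω := algebraMap (RatFunc k) Ω RatFunc.X
  have hy : Transcendental k y := by
    have h1 : Transcendental k (RatFunc.X : RatFunc k) := RatFunc.transcendental_X
    exact (transcendental_algebraMap_iff (algebraMap (RatFunc k) Ω).injective).2 h1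
  obtain ⟨x, hx⟩ : ∃ x : Ω, x ^ q + x = y ^ (q + 1) := by
    have hd : ((Polynomial.X ^ q + (Polynomial.X - Polynomial.C (y ^ (q + 1))) :
        Polynomial Ω)).degree = q := by
      rw [Polynomial.degree_add_eq_left_of_degree_lt]
      · simp
      · rw [Polynomial.degree_X_sub_C, Polynomial.degree_X_pow]
        exact_mod_cast hq
    obtain ⟨x, hx⟩ := IsAlgClosed.exists_root _ (by rw [hd]; exact_mod_cast (by omega : q ≠ 0))
    refine ⟨x, ?_⟩
    simp only [Polynomial.IsRoot.def, Polynomial.eval_add, Polynomial.eval_pow, Polynomial.eval_X,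
      Polynomial.eval_sub, Polynomial.eval_C] at hx
    linear_combination hx
  have hm : 0 < (q ^ n + 1) / (q + 1) :=
    Nat.div_pos (by have := Nat.le_self_pow hn.ne' q; omega) (by omega)
  obtain ⟨z, hz⟩ := IsAlgClosed.exists_pow_nat_eq (y ^ q ^ 2 - y) hm
  let S : IntermediateField k Ω := IntermediateField.adjoin k {x, y, z}
  have mx : x ∈ S := IntermediateField.subset_adjoin _ _ (by simp)
  have my : y ∈ S := IntermediateField.subset_adjoin _ _ (by simp)
  have mz : z ∈ S := IntermediateField.subset_adjoin _ _ (by simp)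
  refine ⟨S, inferInstance, inferInstance, ⟨x, mx⟩, ⟨y, my⟩, ⟨z, mz⟩, ?_, ?_, ?_, ?_⟩
  · apply IntermediateField.lift_injective
    rw [IntermediateField.lift_adjoin, IntermediateField.lift_top]
    simp [Set.image_insert_eq, S]
  · exact (transcendental_algebraMap_iff (R := k) (A := Ω) (S := S)
      (a := ⟨y, my⟩) (algebraMap S Ω).injective).1 hy
  · exact Subtype.ext hx
  · exact Subtype.ext hz

/-! The core is that an automorphism fixing `Q_∞` acts by `y ↦ a y + b`, `x ↦ a^(q+1) x + a b^q y +
c` with `a, b, c ∈ 𝔽_{q²}`, `a ≠ 0` and `c^q + c = b^(q+1)` (`exists_affine_of_smul_eq`). The places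
`Q_{αβ}` correspond to the affine points of the Hermitian curve over `𝔽_{q²}`, so `N(g)` is the
number of fixed points of this map on the curve (`numFixed_eq_encard_affineFixed`).

Affine form. At a pole of `y` the functions `x, y, z` have pole orders `(q+1)m`, `qm`, `q³`, and
since `q` and `m` are coprime the reduced monomials have distinct pole orders. They therefore form a
basis of `R = k[x, y, z]` adapted to the filtration by pole order, and the pole is unique. The ring
`R` is integrally closed: over `k[y]`, `z` is a Kummer generator with squarefree radicand, and `x`
is a generator with étale equation. So `R` is the ring of functions regular away from the pole
(`mem_adjoin_of_forall_mem_valuationSubring`), and `g` preserves `R` and its pole orders. The images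
of `x, y, z` then lie in small spans of monomials, and comparing coefficients in the two defining
equations leaves only the affine form.

Places. Evaluation at `(α, β, 0)` is well defined on `R`, and the local ring there has maximal ideal
`(z)`; hence exactly one place of `C` gives `x, y` the values `α, β`.

Counting. If the affine map fixes a point, it is diagonal with eigenvalues `a` and `a^(q+1)` in
coordinates centred there, so `ord π(g) = ord a` divides `q² - 1` and is prime to `p`. Conversely,
if the order is prime to `p`, no nontrivial translation part can survive and a fixed point exists
(`affineFixed_nonempty_of_pow_fixes`). Given a fixed point: `a = 1` is the identity, with `q³` fixed
points; for `a ≠ 1` the coordinate `β` is forced, and the `q` points above it are all fixed if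
`a^(q+1) = 1`, while only one is fixed otherwise. -/

/-! ### Reduced monomials of `k[x, y, z]` and their weights -/

/-- The monomial `x ^ i * y ^ j * z ^ l`. -/
def gkMono {B : Type*} [CommRing B] (x y z : B) (i : ℕ × ℕ × ℕ) : B :=
  x ^ i.1 * y ^ i.2.1 * z ^ i.2.2

/-- The exponents of the reduced monomials. -/
def gkIdx (q m : ℕ) : Set (ℕ × ℕ × ℕ) := {i | i.1 < q ∧ i.2.2 < m}

/-- The pole order of `x ^ i * y ^ j * z ^ l` at infinity. -/
def gkWt (q m : ℕ) (i : ℕ × ℕ × ℕ) : ℕ := i.1 * ((q + 1) * m) + i.2.1 * (q * m) + i.2.2 * q ^ 3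

/-- Modulo `m` the weight is `l * q ^ 3`, which determines `l < m`. What remains, divided by `m`, is
congruent to `i` modulo `q`, which determines `i < q`, and then `j`. -/
theorem gkWt_injOn {q m : ℕ} (hq : 0 < q) (hm : 0 < m) (hqm : q.Coprime m) :
    Set.InjOn (gkWt q m) (gkIdx q m) := by
  rintro ⟨i, j, l⟩ ⟨hi, hl⟩ ⟨i', j', l'⟩ ⟨hi', hl'⟩ h
  simp only [gkWt] at h hi hl hi' hl'
  have h1 : l * q ^ 3 ≡ l' * q ^ 3 [MOD m] := by
    have e1 : i * ((q + 1) * m) + j * (q * m) + l * q ^ 3 ≡ l * q ^ 3 [MOD m] := by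
      have : i * ((q + 1) * m) + j * (q * m) + l * q ^ 3
          = l * q ^ 3 + (i * (q + 1) + j * q) * m := by ring
      rw [this]; simp [Nat.ModEq]
    have e2 : i' * ((q + 1) * m) + j' * (q * m) + l' * q ^ 3 ≡ l' * q ^ 3 [MOD m] := by
      have : i' * ((q + 1) * m) + j' * (q * m) + l' * q ^ 3
          = l' * q ^ 3 + (i' * (q + 1) + j' * q) * m := by ring
      rw [this]; simp [Nat.ModEq]
    exact e1.symm.trans (h ▸ e2)
  have hll : l = l' :=
    (Nat.ModEq.cancel_right_of_coprime
      ((Nat.Coprime.pow_left 3 hqm).symm) h1).eq_of_lt_of_lt hl hl'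
  subst hll
  have h2 : i * (q + 1) + j * q = i' * (q + 1) + j' * q := by
    apply Nat.eq_of_mul_eq_mul_right hm
    linarith
  have h3 : i ≡ i' [MOD q] := by
    have e1 : i * (q + 1) + j * q = i + (i + j) * q := by ring
    have e2 : i' * (q + 1) + j' * q = i' + (i' + j') * q := by ring
    rw [e1, e2] at h2
    have := congrArg (· % q) h2
    simpa [Nat.ModEq] using this
  have hii : i = i' := h3.eq_of_lt_of_lt hi hi'
  subst hii
  have : j = j' := Nat.eq_of_mul_eq_mul_right hq (by omega)
  subst this
  rfl

section span

variable {k B : Type*} [Field k] [CommRing B] [Algebra k B] {q m : ℕ} {x y z : B}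

theorem gkMono_mem_span {i : ℕ × ℕ × ℕ} (hi : i ∈ gkIdx q m) :
    gkMono x y z i ∈ Submodule.span k (gkMono x y z '' gkIdx q m) :=
  Submodule.subset_span ⟨i, hi, rfl⟩

/-- The two relations rewrite `x ^ q` and `z ^ m`, so the span is stable under multiplication by the
generators. The ring `B` need not be a domain: besides `C`, it is later taken to be `C × k`. -/
theorem mem_span_gkMono_of_mem_adjoin (hq : 2 ≤ q) (hm : 0 < m)
    (hxy : x ^ q + x = y ^ (q + 1)) (hyz : z ^ m = y ^ q ^ 2 - y)
    {r : B} (hr : r ∈ Algebra.adjoin k {x, y, z}) :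
    r ∈ Submodule.span k (gkMono x y z '' gkIdx q m) := by
  set S := Submodule.span k (gkMono x y z '' gkIdx q m) with hS
  have key : ∀ w : B, (∀ i ∈ gkIdx q m, gkMono x y z i * w ∈ S) → ∀ s ∈ S, s * w ∈ S := by
    intro w hw s hs
    induction hs using Submodule.span_induction with
    | mem s hs => obtain ⟨i, hi, rfl⟩ := hs; exact hw i hi
    | zero => simp
    | add s t _ _ h1 h2 => rw [add_mul]; exact S.add_mem h1 h2
    | smul c s _ h => rw [smul_mul_assoc]; exact S.smul_mem c h
  have hx : ∀ s ∈ S, s * x ∈ S := by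
    refine key x ?_
    rintro ⟨i, j, l⟩ ⟨hi, hl⟩
    simp only at hi hl
    rcases Nat.lt_or_ge (i + 1) q with h | h
    · convert gkMono_mem_span (k := k) (x := x) (y := y) (z := z)
        (show (i + 1, j, l) ∈ gkIdx q m from ⟨h, hl⟩) using 1
      simp only [gkMono]; ring
    · have hiq : q = i + 1 := by omega
      have : gkMono x y z (i, j, l) * x
          = gkMono x y z (0, j + (q + 1), l) - gkMono x y z (1, j, l) := by
        simp only [gkMono]
        have h' : x ^ i * x = y ^ (q + 1) - x := by rw [← pow_succ, ← hiq, ← hxy]; ring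
        calc x ^ i * y ^ j * z ^ l * x = (x ^ i * x) * y ^ j * z ^ l := by ring
          _ = _ := by rw [h']; ring
      rw [this]
      exact S.sub_mem (gkMono_mem_span ⟨by simp only; omega, hl⟩)
        (gkMono_mem_span ⟨by simp only; omega, hl⟩)
  have hy : ∀ s ∈ S, s * y ∈ S := by
    refine key y ?_
    rintro ⟨i, j, l⟩ ⟨hi, hl⟩
    convert gkMono_mem_span (k := k) (x := x) (y := y) (z := z)
      (show (i, j + 1, l) ∈ gkIdx q m from ⟨hi, hl⟩) using 1
    simp only [gkMono]; ring
  have hz : ∀ s ∈ S, s * z ∈ S := by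
    refine key z ?_
    rintro ⟨i, j, l⟩ ⟨hi, hl⟩
    simp only at hi hl
    rcases Nat.lt_or_ge (l + 1) m with h | h
    · convert gkMono_mem_span (k := k) (x := x) (y := y) (z := z)
        (show (i, j, l + 1) ∈ gkIdx q m from ⟨hi, h⟩) using 1
      simp only [gkMono]; ring
    · have hlm : m = l + 1 := by omega
      have : gkMono x y z (i, j, l) * z
          = gkMono x y z (i, j + q ^ 2, 0) - gkMono x y z (i, j + 1, 0) := by
        simp only [gkMono]
        have h' : z ^ l * z = y ^ q ^ 2 - y := by rw [← pow_succ, ← hlm, hyz]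
        calc x ^ i * y ^ j * z ^ l * z = x ^ i * y ^ j * (z ^ l * z) := by ring
          _ = _ := by rw [h']; ring
      rw [this]
      exact S.sub_mem (gkMono_mem_span ⟨hi, hm⟩) (gkMono_mem_span ⟨hi, hm⟩)
  have h1 : (1 : B) ∈ S := by
    convert gkMono_mem_span (k := k) (x := x) (y := y) (z := z)
      (show (0, 0, 0) ∈ gkIdx q m from ⟨by simp only; omega, hm⟩) using 1
    simp [gkMono]
  have main : ∀ s ∈ S, s * r ∈ S := by
    induction hr using Algebra.adjoin_induction with
    | mem w hw =>
      rcases hw with rfl | rfl | rfl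
      exacts [hx, hy, hz]
    | algebraMap c =>
      intro s hs
      rw [mul_comm, ← Algebra.smul_def]
      exact S.smul_mem c hs
    | add a b _ _ ha hb => intro s hs; rw [mul_add]; exact S.add_mem (ha s hs) (hb s hs)
    | mul a b _ _ ha hb => intro s hs; rw [← mul_assoc]; exact hb _ (ha s hs)
  simpa using main 1 h1

theorem exists_finsupp_of_mem_adjoin (hq : 2 ≤ q) (hm : 0 < m)
    (hxy : x ^ q + x = y ^ (q + 1)) (hyz : z ^ m = y ^ q ^ 2 - y)
    {r : B} (hr : r ∈ Algebra.adjoin k {x, y, z}) :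
    ∃ f : (ℕ × ℕ × ℕ) →₀ k, ↑f.support ⊆ gkIdx q m ∧
      Finsupp.linearCombination k (gkMono x y z) f = r := by
  have := mem_span_gkMono_of_mem_adjoin hq hm hxy hyz hr
  rw [Finsupp.mem_span_image_iff_linearCombination] at this
  obtain ⟨f, hf, rfl⟩ := this
  exact ⟨f, hf, rfl⟩

end span

/-! ### Pole orders at a pole of `y`, and uniqueness of that pole -/

section pole

variable {k C : Type*} [Field k] [Field C] [Algebra k C] {q m : ℕ} {x y z : C}
  {P : ValuationSubring C}

/-- The relations give `v x ^ q = v y ^ (q + 1)` and `v z ^ m = v y ^ q ^ 2`. So `W = v x / v y` has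
`W ^ q = v y`, `W ^ (q + 1) = v x` and `W ^ q ^ 3 = v z ^ m`. As `m` and `q ^ 3` are coprime, a
Bézout combination of `W` and `v z` is a common root `T` with `T ^ m = W` and `T ^ q ^ 3 = v z`. The
value group is not assumed discrete. -/
theorem exists_valuation_gkMono (hq : 2 ≤ q) (hm : 0 < m) (hqm : q.Coprime m)
    (hxy : x ^ q + x = y ^ (q + 1)) (hyz : z ^ m = y ^ q ^ 2 - y) (hy : y ∉ P) :
    ∃ T : P.ValueGroup, 1 < T ∧
      ∀ i, P.valuation (gkMono x y z i) = T ^ gkWt q m i := by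
  set v := P.valuation
  have hY : 1 < v y := by
    rw [← not_le]; exact fun h => hy ((P.valuation_le_one_iff y).1 h)
  have hX : 1 < v x := by
    by_contra h
    rw [not_lt] at h
    have h1 : v (y ^ (q + 1)) ≤ 1 := by
      rw [← hxy]
      exact v.map_add_le (by rw [map_pow]; exact pow_le_one' h _) h
    rw [map_pow] at h1
    exact absurd h1 (not_le.2 (one_lt_pow' hY (by omega)))
  have hXq : v x ^ q = v y ^ (q + 1) := by
    rw [← map_pow, ← map_pow, ← hxy]
    refine (v.map_add_eq_of_lt_left ?_).symm
    rw [map_pow]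
    exact lt_self_pow₀ hX (by omega)
  have hZ : v z ^ m = v y ^ q ^ 2 := by
    rw [← map_pow, ← map_pow, hyz]
    refine v.map_sub_eq_of_lt_left ?_
    rw [map_pow]
    exact lt_self_pow₀ hY (by nlinarith)
  have hY0 : v y ≠ 0 := (zero_lt_one.trans hY).ne'
  have hX0 : v x ≠ 0 := (zero_lt_one.trans hX).ne'
  have hZ0 : v z ≠ 0 := by
    intro h
    rw [h, zero_pow hm.ne'] at hZ
    exact pow_ne_zero _ hY0 hZ.symm
  set W := v x / v y with hW
  have hW0 : W ≠ 0 := div_ne_zero hX0 hY0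
  have hWq : W ^ q = v y := by
    rw [hW, div_pow, hXq, pow_succ, mul_div_cancel_left₀ _ (pow_ne_zero _ hY0)]
  have hWx : W ^ (q + 1) = v x := by
    rw [pow_succ, hWq, hW, mul_div_cancel₀ _ hY0]
  have hWz : v z ^ m = W ^ q ^ 3 := by
    rw [hZ, ← hWq, ← pow_mul]; congr 1; ring
  have hbez : (m : ℤ) * Nat.gcdA m (q ^ 3) + (q ^ 3 : ℕ) * Nat.gcdB m (q ^ 3) = 1 := by
    rw [← Nat.gcd_eq_gcd_ab, (Nat.Coprime.pow_left 3 hqm).symm.gcd_eq_one]; rfl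
  set a := Nat.gcdA m (q ^ 3)
  set b := Nat.gcdB m (q ^ 3)
  have hTm : (W ^ a * v z ^ b) ^ m = W := by
    rw [mul_pow, ← zpow_natCast (v z ^ b), ← zpow_mul, mul_comm b, zpow_mul, zpow_natCast, hWz,
      ← zpow_natCast (W ^ a), ← zpow_mul, ← zpow_natCast W, ← zpow_mul, ← zpow_add₀ hW0,
      mul_comm a, hbez, zpow_one]
  have hTz : (W ^ a * v z ^ b) ^ q ^ 3 = v z := by
    rw [mul_pow, ← zpow_natCast (W ^ a), ← zpow_mul, mul_comm a, zpow_mul, zpow_natCast, ← hWz,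
      ← zpow_natCast (v z ^ b), ← zpow_mul, ← zpow_natCast (v z), ← zpow_mul, ← zpow_add₀ hZ0,
      mul_comm b, hbez, zpow_one]
  refine ⟨W ^ a * v z ^ b, ?_, ?_⟩
  · by_contra h
    rw [not_lt] at h
    have h1 : W ≤ 1 := by rw [← hTm]; exact pow_le_one' h _
    have h2 : v y ≤ 1 := by rw [← hWq]; exact pow_le_one' h1 _
    exact absurd h2 (not_le.2 hY)
  · rintro ⟨i, j, l⟩
    simp only [gkMono, gkWt, map_mul, map_pow]
    rw [← hWx, ← hWq]
    generalize hTe : W ^ a * v z ^ b = T at hTm hTz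
    rw [← hTz, ← hTm]
    simp only [← pow_mul]
    rw [← pow_add, ← pow_add]
    congr 1
    ring

theorem valuation_algebraMap_eq_one (hk : ∀ c : k, algebraMap k C c ∈ P) {c : k} (hc : c ≠ 0) :
    P.valuation (algebraMap k C c) = 1 := by
  refine le_antisymm ((P.valuation_le_one_iff _).2 (hk c)) ?_
  have h := (P.valuation_le_one_iff _).2 (hk c⁻¹)
  rw [map_inv₀, map_inv₀] at h
  exact (inv_le_one₀ (zero_lt_iff.2 (by simpa using hc))).1 h

/-- A reduced polynomial in `x`, `y`, `z` has the pole order of its leading monomial. -/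
theorem valuation_linearCombination (hq : 2 ≤ q) (hm : 0 < m) (hqm : q.Coprime m)
    (hk : ∀ c : k, algebraMap k C c ∈ P)
    {T : P.ValueGroup} (hT : 1 < T) (hTi : ∀ i, P.valuation (gkMono x y z i) = T ^ gkWt q m i)
    {f : (ℕ × ℕ × ℕ) →₀ k} (hf : ↑f.support ⊆ gkIdx q m) (hf0 : f ≠ 0) :
    P.valuation (Finsupp.linearCombination k (gkMono x y z) f)
      = T ^ f.support.sup (gkWt q m) := by
  obtain ⟨i, hi, hmax⟩ := f.support.exists_max_image (gkWt q m) (Finsupp.support_nonempty_iff.2 hf0)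
  have hsup : f.support.sup (gkWt q m) = gkWt q m i :=
    le_antisymm (Finset.sup_le hmax) (Finset.le_sup hi)
  have hval : ∀ j ∈ f.support, P.valuation (f j • gkMono x y z j) = T ^ gkWt q m j := by
    intro j hj
    rw [Algebra.smul_def, map_mul, hTi,
      valuation_algebraMap_eq_one hk (Finsupp.mem_support_iff.1 hj), one_mul]
  rw [hsup, Finsupp.linearCombination_apply, Finsupp.sum, ← Finset.add_sum_erase _ _ hi,
    P.valuation.map_add_eq_of_lt_left, hval i hi]
  rw [hval i hi]
  refine P.valuation.map_sum_lt (pow_ne_zero _ (zero_lt_one.trans hT).ne') ?_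
  intro j hj
  obtain ⟨hji, hj⟩ := Finset.mem_erase.1 hj
  rw [hval j hj]
  refine pow_lt_pow_right₀ hT (lt_of_le_of_ne (hmax j hj) ?_)
  exact fun h => hji (gkWt_injOn (by omega) hm hqm (hf hj) (hf hi) h)

theorem linearCombination_gkMono_eq_zero (hq : 2 ≤ q) (hm : 0 < m) (hqm : q.Coprime m)
    (hxy : x ^ q + x = y ^ (q + 1)) (hyz : z ^ m = y ^ q ^ 2 - y)
    (hk : ∀ c : k, algebraMap k C c ∈ P) (hy : y ∉ P)
    {f : (ℕ × ℕ × ℕ) →₀ k} (hf : ↑f.support ⊆ gkIdx q m)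
    (h0 : Finsupp.linearCombination k (gkMono x y z) f = 0) : f = 0 := by
  by_contra hf0
  obtain ⟨T, hT, hTi⟩ := exists_valuation_gkMono hq hm hqm hxy hyz hy
  have := valuation_linearCombination hq hm hqm hk hT hTi hf hf0
  rw [h0, map_zero] at this
  exact pow_ne_zero _ (zero_lt_one.trans hT).ne' this.symm

/-- An element of `k[x, y, z]` of pole order at most `d` is a combination of the reduced monomials
of pole order at most `d`. -/
theorem mem_span_gkMono_of_valuation_le (hq : 2 ≤ q) (hm : 0 < m) (hqm : q.Coprime m)
    (hxy : x ^ q + x = y ^ (q + 1)) (hyz : z ^ m = y ^ q ^ 2 - y)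
    (hk : ∀ c : k, algebraMap k C c ∈ P)
    {T : P.ValueGroup} (hT : 1 < T) (hTi : ∀ i, P.valuation (gkMono x y z i) = T ^ gkWt q m i)
    {r : C} (hr : r ∈ Algebra.adjoin k {x, y, z}) {d : ℕ} (hd : P.valuation r ≤ T ^ d) :
    r ∈ Submodule.span k (gkMono x y z '' {i ∈ gkIdx q m | gkWt q m i ≤ d}) := by
  obtain ⟨f, hf, rfl⟩ := exists_finsupp_of_mem_adjoin hq hm hxy hyz hr
  rcases eq_or_ne f 0 with rfl | hf0
  · simp
  rw [valuation_linearCombination hq hm hqm hk hT hTi hf hf0] at hd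
  have hd' := (pow_le_pow_iff_right₀ hT).1 hd
  rw [Finsupp.mem_span_image_iff_linearCombination]
  exact ⟨f, fun i hi => ⟨hf hi, (Finset.le_sup hi).trans hd'⟩, rfl⟩

/-- On `k[x, y, z]` the pole order at a pole of `y` does not depend on the pole. -/
theorem exists_valuation_eq_pow (hq : 2 ≤ q) (hm : 0 < m) (hqm : q.Coprime m)
    (hxy : x ^ q + x = y ^ (q + 1)) (hyz : z ^ m = y ^ q ^ 2 - y)
    {r : C} (hr : r ∈ Algebra.adjoin k {x, y, z}) (hr0 : r ≠ 0) :
    ∃ d : ℕ, ∀ (P : ValuationSubring C), (∀ c : k, algebraMap k C c ∈ P) →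
      ∀ T : P.ValueGroup, 1 < T → (∀ i, P.valuation (gkMono x y z i) = T ^ gkWt q m i) →
        P.valuation r = T ^ d := by
  obtain ⟨f, hf, rfl⟩ := exists_finsupp_of_mem_adjoin hq hm hxy hyz hr
  have hf0 : f ≠ 0 := by rintro rfl; simp at hr0
  exact ⟨_, fun P hk T hT hTi => valuation_linearCombination hq hm hqm hk hT hTi hf hf0⟩

/-- Every element of `C` is a quotient `r / s` of elements of `k[x, y, z]`, and the exponents of `T`
in the values of `r` and `s` are the same at both poles; they decide membership. -/
theorem pole_unique (hq : 2 ≤ q) (hm : 0 < m) (hqm : q.Coprime m)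
    (htop : IntermediateField.adjoin k {x, y, z} = ⊤)
    (hxy : x ^ q + x = y ^ (q + 1)) (hyz : z ^ m = y ^ q ^ 2 - y)
    {P P' : ValuationSubring C} (hk : ∀ c : k, algebraMap k C c ∈ P) (hy : y ∉ P)
    (hk' : ∀ c : k, algebraMap k C c ∈ P') (hy' : y ∉ P') : P = P' := by
  obtain ⟨T, hT, hTi⟩ := exists_valuation_gkMono hq hm hqm hxy hyz hy
  obtain ⟨T', hT', hTi'⟩ := exists_valuation_gkMono hq hm hqm hxy hyz hy'
  ext c
  have hc : c ∈ IntermediateField.adjoin k {x, y, z} := htop ▸ IntermediateField.mem_top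
  obtain ⟨r, hr, s, hs, rfl⟩ := IntermediateField.mem_adjoin_iff_div.1 hc
  rcases eq_or_ne r 0 with rfl | hr0
  · simp [zero_mem]
  rcases eq_or_ne s 0 with rfl | hs0
  · simp [zero_mem]
  obtain ⟨d, hd⟩ := exists_valuation_eq_pow (k := k) hq hm hqm hxy hyz hr hr0
  obtain ⟨d', hd'⟩ := exists_valuation_eq_pow (k := k) hq hm hqm hxy hyz hs hs0
  rw [← P.valuation_le_one_iff, ← P'.valuation_le_one_iff, map_div₀, map_div₀,
    hd P hk T hT hTi, hd' P hk T hT hTi, hd P' hk' T' hT' hTi', hd' P' hk' T' hT' hTi',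
    div_le_one₀ (pow_pos (zero_lt_one.trans hT) _), div_le_one₀ (pow_pos (zero_lt_one.trans hT') _),
    pow_le_pow_iff_right₀ hT, pow_le_pow_iff_right₀ hT']

end pole

/-! ### Linear independence over `k[y]` -/

/-- The evaluation `k[Y][Z] → C` at `Y = y`, `Z = z`. -/
noncomputable def gkEval (k : Type*) {C : Type*} [Field k] [Field C] [Algebra k C] (y z : C) :
    Polynomial (Polynomial k) →+* C :=
  Polynomial.eval₂RingHom (Polynomial.aeval (R := k) y).toRingHom z

section indep

variable {k C : Type*} [Field k] [Field C] [Algebra k C] {q m : ℕ} {x y z : C}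
  {P : ValuationSubring C}

@[simp] theorem gkEval_X : gkEval k y z Polynomial.X = z := by simp [gkEval]

@[simp] theorem gkEval_C (p : Polynomial k) :
    gkEval k y z (Polynomial.C p) = Polynomial.aeval y p := by simp [gkEval]

@[simp] theorem gkEval_map_C (p : Polynomial k) :
    gkEval k y z (p.map Polynomial.C) = Polynomial.aeval z p := by
  simp only [gkEval, Polynomial.coe_eval₂RingHom, Polynomial.eval₂_map, Polynomial.aeval_def]
  congr 1
  ext c
  simp

/-- The elements `x ^ i * y ^ j * z ^ l` for `i < q`, `l < m` are linearly independent. -/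
theorem eq_zero_of_sum_gkEval_eq_zero (hq : 2 ≤ q) (hm : 0 < m) (hqm : q.Coprime m)
    (hxy : x ^ q + x = y ^ (q + 1)) (hyz : z ^ m = y ^ q ^ 2 - y)
    (hk : ∀ c : k, algebraMap k C c ∈ P) (hy : y ∉ P)
    (F : ℕ → Polynomial (Polynomial k)) (hF : ∀ i < q, (F i).natDegree < m)
    (h0 : ∑ i ∈ Finset.range q, x ^ i * gkEval k y z (F i) = 0) : ∀ i < q, F i = 0 := by
  -- `N` exceeds all degrees in `y`, so the coefficients of the `F i` can be collected in one
  -- finitely supported function.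
  let N : ℕ := (Finset.range q ×ˢ Finset.range m).sup
    (fun a => ((F a.1).coeff a.2).natDegree) + 1
  have hN : ∀ i < q, ∀ l < m, ((F i).coeff l).natDegree < N := by
    intro i hi l hl
    exact Nat.lt_succ_of_le (Finset.le_sup (f := fun a : ℕ × ℕ => ((F a.1).coeff a.2).natDegree)
      (b := (i, l)) (Finset.mem_product.2 ⟨Finset.mem_range.2 hi, Finset.mem_range.2 hl⟩))
  let s : Finset (ℕ × ℕ × ℕ) := Finset.range q ×ˢ (Finset.range N ×ˢ Finset.range m)
  let f0 : ℕ × ℕ × ℕ → k := fun a => ((F a.1).coeff a.2.2).coeff a.2.1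
  let f : (ℕ × ℕ × ℕ) →₀ k := ∑ a ∈ s, Finsupp.single a (f0 a)
  have hfa : ∀ a, f a = if a ∈ s then f0 a else 0 := by
    intro a
    simp only [f, Finsupp.finsetSum_apply, Finsupp.single_apply, Finset.sum_ite_eq']
  have hfs : ↑f.support ⊆ gkIdx q m := by
    intro a ha
    rw [Finset.mem_coe, Finsupp.mem_support_iff, hfa] at ha
    have has : a ∈ s := by
      by_contra h; exact ha (if_neg h)
    simp only [s, Finset.mem_product, Finset.mem_range] at has
    exact ⟨has.1, has.2.2⟩
  have hf0 : f = 0 := by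
    refine linearCombination_gkMono_eq_zero hq hm hqm hxy hyz hk hy hfs ?_
    rw [← h0, map_sum, Finset.sum_product]
    refine Finset.sum_congr rfl fun i hi => ?_
    rw [Finset.mem_range] at hi
    rw [gkEval, Polynomial.coe_eval₂RingHom, Polynomial.eval₂_eq_sum_range' _ (hF i hi),
      Finset.mul_sum, Finset.sum_product_right]
    refine Finset.sum_congr rfl fun l hl => ?_
    rw [Finset.mem_range] at hl
    rw [AlgHom.toRingHom_eq_coe, RingHom.coe_coe, Polynomial.aeval_eq_sum_range' (hN i hi l hl),
      Finset.sum_mul, Finset.mul_sum]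
    refine Finset.sum_congr rfl fun j _ => ?_
    rw [Finsupp.linearCombination_single, Algebra.smul_def, Algebra.smul_def, gkMono]
    ring
  intro i hi
  ext l j
  rcases lt_or_ge l m with hl | hl
  · rcases lt_or_ge j N with hj | hj
    · have := hfa (i, j, l)
      rw [hf0, if_pos (by simp [s, hi, hj, hl])] at this
      simpa using this.symm
    · rw [Polynomial.coeff_eq_zero_of_natDegree_lt ((hN i hi l hl).trans_le hj)]
      simp
  · rw [Polynomial.coeff_eq_zero_of_natDegree_lt ((hF i hi).trans_le hl)]
    simp

end indep

/-! ### Integral closedness of `k[x, y, z]` -/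

section normality

open Polynomial

theorem PowerBasis.isSeparable_of_separable_minpoly {K L : Type*} [Field K] [Field L] [Algebra K L]
    (B : PowerBasis K L) (h : (minpoly K B.gen).Separable) : Algebra.IsSeparable K L := by
  have h1 : IsSeparable K B.gen := h
  have h2 := (IntermediateField.isSeparable_adjoin_simple_iff_isSeparable K L).2 h1
  have h3 : IntermediateField.adjoin K {B.gen} = ⊤ := by
    rw [eq_top_iff]
    intro c _
    have : c ∈ Algebra.adjoin K {B.gen} := by rw [B.adjoin_gen_eq_top]; trivial
    exact IntermediateField.algebra_adjoin_le_adjoin K _ this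
  rw [h3] at h2
  exact Algebra.IsSeparable.of_algHom _ _ IntermediateField.topEquiv.symm.toAlgHom

variable {R K L : Type*} [CommRing R] [IsIntegrallyClosed R] [Field K] [Field L]
  [Algebra R K] [IsFractionRing R K] [Algebra K L] [Algebra R L] [IsScalarTower R K L]

/-- The étale case: `R[α]` is integrally closed if the derivative of the minimal polynomial of `α`
takes the value `1` at `α`. -/
theorem PowerBasis.mem_adjoin_of_aeval_derivative_eq_one (B : PowerBasis K L)
    (hB : IsIntegral R B.gen) (hsep : (minpoly K B.gen).Separable)
    (hder : aeval B.gen (derivative (minpoly K B.gen)) = 1) {c : L} (hc : IsIntegral R c) :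
    c ∈ Algebra.adjoin R {B.gen} := by
  have := B.isSeparable_of_separable_minpoly hsep
  have := B.finite
  -- The discriminant multiplies integral elements into `R[α]`; up to sign it is the norm of the
  -- derivative at `α`, here `1`.
  have h := Algebra.discr_mul_isIntegral_mem_adjoin K hB hc
  rw [Algebra.discr_powerBasis_eq_norm, hder, map_one, mul_one] at h
  rcases neg_one_pow_eq_or K (Module.finrank K L * (Module.finrank K L - 1) / 2) with h1 | h1 <;>
    rw [h1] at h
  · simpa using h
  · simpa using neg_mem h

/-- The Kummer case: `R[α]` is integrally closed if `α ^ m` is squarefree, for `m` a unit. -/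
theorem PowerBasis.mem_adjoin_of_pow_squarefree [IsDomain R] [IsPrincipalIdealRing R] (B : PowerBasis K L)
    {m : ℕ} (hm : 0 < m) (hm1 : (m : R) = 1) {D : R} (hD : Squarefree D) (hD0 : D ≠ 0)
    (hmin : minpoly K B.gen = X ^ m - C (algebraMap R K D)) {c : L} (hc : IsIntegral R c) :
    c ∈ Algebra.adjoin R {B.gen} := by
  have hB : IsIntegral R B.gen := by
    refine ⟨X ^ m - C D, monic_X_pow_sub_C D hm.ne', ?_⟩
    have := minpoly.aeval K B.gen
    rw [hmin] at this
    simpa [← IsScalarTower.algebraMap_apply] using this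
  have hminR : minpoly R B.gen = X ^ m - C D := by
    apply map_injective (algebraMap R K) (IsFractionRing.injective R K)
    refine (minpoly.isIntegrallyClosed_eq_field_fractions K L hB).symm.trans ?_
    simpa using hmin
  have hm1K : (m : K) = 1 := by
    rw [← map_natCast (algebraMap R K), hm1, map_one]
  have hDK : algebraMap R K D ≠ 0 := by
    simpa using hD0
  have hsep : (minpoly K B.gen).Separable := by
    rw [hmin]
    exact separable_X_pow_sub_C _ (by rw [hm1K]; exact one_ne_zero) hDK
  have := B.isSeparable_of_separable_minpoly hsep
  have hfin := B.finite
  have hnorm : Algebra.norm K B.gen ^ 2 = algebraMap R K (D ^ 2) := by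
    rw [Algebra.PowerBasis.norm_gen_eq_coeff_zero_minpoly, hmin]
    simp [coeff_X_pow, hm.ne, mul_pow, ← pow_mul, mul_comm _ 2]
  have h := Algebra.discr_mul_isIntegral_mem_adjoin K hB hc
  set dd := Algebra.discr K B.basis with hdd
  -- Squaring removes the signs of the discriminant and of the norm of the generator.
  have h2 : dd ^ 2 = algebraMap R K (D ^ (2 * (m - 1))) := by
    rw [hdd, Algebra.discr_powerBasis_eq_norm, hmin, mul_pow, ← pow_mul, mul_comm _ 2, pow_mul]
    simp only [derivative_sub, derivative_X_pow, derivative_C, sub_zero, map_pow,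
      hm1K, map_one, one_mul, even_two, Even.neg_pow, one_pow, aeval_X]
    simp only [← pow_mul]
    rw [mul_comm (m - 1) 2, pow_mul, hnorm, pow_mul, map_pow]
  have hdint : IsIntegral R (algebraMap K L dd) :=
    (Algebra.discr_isIntegral K fun i => by rw [B.basis_eq_pow]; exact hB.pow _).map
      (IsScalarTower.toAlgHom R K L)
  -- A prime dividing the squarefree `D` divides it exactly once, so `X ^ m - D` is Eisenstein there
  -- and the prime can be cancelled from `d`. The prime factors of `d` are removed one at a time.
  have key : ∀ d : R, d ∣ D ^ (2 * (m - 1)) → ∀ c : L, IsIntegral R c →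
      d • c ∈ Algebra.adjoin R {B.gen} → c ∈ Algebra.adjoin R {B.gen} := by
    intro d
    induction d using UniqueFactorizationMonoid.induction_on_prime with
    | h₁ => intro h; exact absurd (zero_dvd_iff.1 h) (pow_ne_zero _ hD0)
    | h₂ u hu =>
      intro _ c _ hc
      obtain ⟨u, rfl⟩ := hu
      have := Subalgebra.smul_mem _ hc (↑u⁻¹ : R)
      rwa [smul_smul, Units.inv_mul, one_smul] at this
    | h₃ d p hd0 hp ih =>
      intro hdvd c hc hcm
      refine ih ((dvd_mul_left d p).trans hdvd) c hc ?_
      rw [mul_smul] at hcm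
      refine mem_adjoin_of_smul_prime_smul_of_minpoly_isEisensteinAt (K := K) hp hB
        (hc.smul d) hcm ?_
      have hpD : p ∣ D := hp.dvd_of_dvd_pow ((dvd_mul_right p d).trans hdvd)
      rw [hminR]
      refine ⟨?_, ?_, ?_⟩
      · rw [(monic_X_pow_sub_C D hm.ne').leadingCoeff, Ideal.mem_span_singleton]
        exact fun h => hp.not_isUnit (isUnit_of_dvd_one h)
      · intro n hn
        rw [natDegree_X_pow_sub_C] at hn
        rw [Ideal.mem_span_singleton]
        rcases eq_or_ne n 0 with rfl | hn0
        · simpa [coeff_X_pow, hm.ne] using hpD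
        · simp [coeff_X_pow, hn.ne, coeff_C, hn0]
      · rw [Ideal.span_singleton_pow, Ideal.mem_span_singleton]
        intro h
        have h' : p ^ 2 ∣ D := by simpa [coeff_X_pow, hm.ne] using h
        exact hp.not_isUnit (hD p (by rwa [← sq]))
  refine key _ dvd_rfl c hc ?_
  -- `dd • c` is itself integral, so the discriminant bound applies to it and yields `dd ^ 2 • c ∈
  -- R[α]`.
  rw [← algebraMap_smul K, ← h2, sq, mul_smul]
  have hdc : dd • c = algebraMap K L dd * c := Algebra.smul_def _ _
  exact Algebra.discr_mul_isIntegral_mem_adjoin K hB (hdc ▸ hdint.mul hc)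

end normality

section normality

open Polynomial IntermediateField

/-- The tower `K ⊆ K(z) ⊆ C` is handled one storey at a time. The upper one is étale, as `X ^ q + X
- b` has derivative `1`, so an integral element is a polynomial in `x` over the integral closure of
`A` in `K(z)`. The lower one is the Kummer case, so that closure is `A[z]`. -/
theorem mem_adjoin_of_isIntegral_of_tower {A : Type*} (K : Type*) {C : Type*} [CommRing A]
    [IsDomain A]
    [IsPrincipalIdealRing A] [Field K] [Algebra A K] [IsFractionRing A K] [Field C] [Algebra K C]
    [Algebra A C] [IsScalarTower A K C] {q m : ℕ} (hq : 2 ≤ q) (hm : 0 < m) (hqA : (q : A) = 0)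
    (hmA : (m : A) = 1) {x z : C} {b D : A} (hx : x ^ q + x = algebraMap A C b)
    (hz : z ^ m = algebraMap A C D) (hD : Squarefree D) (hD0 : D ≠ 0)
    (hli : LinearIndependent K (fun i : Fin q × Fin m => x ^ (i.1 : ℕ) * z ^ (i.2 : ℕ)))
    (htop : IntermediateField.adjoin K {x, z} = ⊤) {c : C} (hc : IsIntegral A c) :
    c ∈ Algebra.adjoin A {x, z} := by
  have hzroot : aeval z (X ^ m - Polynomial.C (algebraMap A K D)) = 0 := by
    simp [hz, ← IsScalarTower.algebraMap_apply]
  have hzmon : (X ^ m - Polynomial.C (algebraMap A K D)).Monic := monic_X_pow_sub_C _ hm.ne'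
  have hzint : IsIntegral K z := ⟨_, hzmon, by simpa [aeval_def] using hzroot⟩
  set L := IntermediateField.adjoin K {z} with hL
  let Bz : PowerBasis K L := IntermediateField.adjoin.powerBasis hzint
  have hBz : Bz.gen = AdjoinSimple.gen K z := IntermediateField.adjoin.powerBasis_gen hzint
  have hfinL : FiniteDimensional K L := Bz.finite
  have : IsScalarTower A L C := IsScalarTower.of_algebraMap_eq fun a => by
    rw [IsScalarTower.algebraMap_apply A K L, ← IsScalarTower.algebraMap_apply K L C,
      ← IsScalarTower.algebraMap_apply A K C]
  have hdegz : Module.finrank K L ≤ m := by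
    rw [hL, IntermediateField.adjoin.finrank hzint, ← natDegree_X_pow_sub_C (n := m)
      (r := algebraMap A K D)]
    exact natDegree_le_of_dvd (minpoly.dvd K z hzroot) hzmon.ne_zero
  let fx : L[X] := X ^ q + (X - Polynomial.C (algebraMap A L b))
  have hlt : (X - Polynomial.C (algebraMap A L b)).degree < (q : WithBot ℕ) := by
    rw [degree_X_sub_C]; exact_mod_cast hq
  have hxmon : fx.Monic := monic_X_pow_add hlt
  have hxdeg : fx.natDegree = q := by
    rw [natDegree_eq_of_degree_eq_some]
    rw [degree_add_eq_left_of_degree_lt (by rwa [degree_X_pow]), degree_X_pow]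
  have hxroot : aeval x fx = 0 := by
    simp only [fx, map_add, map_sub, map_pow, aeval_X, aeval_C,
      ← IsScalarTower.algebraMap_apply A L C, ← hx]
    ring
  have hxint : IsIntegral L x := ⟨fx, hxmon, by simpa [aeval_def] using hxroot⟩
  have htopx : IntermediateField.adjoin L {x} = ⊤ := by
    rw [← IntermediateField.restrictScalars_eq_top_iff (K := K), hL,
      IntermediateField.adjoin_adjoin_left, ← htop]
    congr 1
    ext; simp
  have htopx' : Algebra.adjoin L {x} = ⊤ := by
    rw [← IntermediateField.adjoin_simple_toSubalgebra_of_isAlgebraic hxint.isAlgebraic, htopx]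
    rfl
  let Bx : PowerBasis L C := PowerBasis.ofAdjoinEqTop hxint htopx'
  have hBx : Bx.gen = x := rfl
  have hfinC : FiniteDimensional L C := Bx.finite
  have hdegx : Module.finrank L C ≤ q := by
    rw [Bx.finrank, PowerBasis.ofAdjoinEqTop_dim, ← hxdeg]
    exact natDegree_le_of_dvd (minpoly.dvd L x hxroot) hxmon.ne_zero
  have hfinKC : FiniteDimensional K C := FiniteDimensional.trans K L C
  -- The independent family makes both degree bounds equalities, so the two given equations are the
  -- minimal polynomials.
  have hcard : q * m ≤ Module.finrank K L * Module.finrank L C := by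
    rw [Module.finrank_mul_finrank]
    simpa using hli.fintype_card_le_finrank
  have hposL : 0 < Module.finrank K L := Module.finrank_pos
  have hdegz' : Module.finrank K L = m := by nlinarith
  have hdegx' : Module.finrank L C = q := by
    rw [hdegz'] at hcard
    exact le_antisymm hdegx (Nat.le_of_mul_le_mul_left (by linarith) hm)
  have hminz : minpoly K Bz.gen = X ^ m - Polynomial.C (algebraMap A K D) := by
    rw [hBz, minpoly_gen]
    refine (eq_of_monic_of_dvd_of_natDegree_le (minpoly.monic hzint) hzmon
      (minpoly.dvd K z hzroot) ?_).symm
    rw [natDegree_X_pow_sub_C, ← IntermediateField.adjoin.finrank hzint, ← hL, hdegz']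
  have hminx : minpoly L Bx.gen = fx := by
    rw [hBx]
    refine (eq_of_monic_of_dvd_of_natDegree_le (minpoly.monic hxint) hxmon
      (minpoly.dvd L x hxroot) ?_).symm
    have : (minpoly L x).natDegree = q := by
      rw [← hdegx', Bx.finrank, PowerBasis.ofAdjoinEqTop_dim]
    rw [hxdeg, this]
  have hqL : (q : L) = 0 := by
    rw [← map_natCast (algebraMap A L), hqA, map_zero]
  have hderx : derivative fx = 1 := by
    simp [fx, derivative_X_pow, hqL]
  have : IsFractionRing (integralClosure A L) L :=
    integralClosure.isFractionRing_of_finite_extension K L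
  have : IsIntegrallyClosed (integralClosure A L) :=
    integralClosure.isIntegrallyClosedOfFiniteExtension K
  have hcx : c ∈ Algebra.adjoin (integralClosure A L) {x} := by
    refine Bx.mem_adjoin_of_aeval_derivative_eq_one ?_ ?_ ?_ ?_
    · refine IsIntegral.tower_top (R := A) ⟨X ^ q + (X - Polynomial.C b), ?_, ?_⟩
      · exact monic_X_pow_add (by rw [degree_X_sub_C]; exact_mod_cast hq)
      · simp only [eval₂_add, eval₂_sub, eval₂_pow, eval₂_X, eval₂_C, hBx, ← hx]
        ring
    · rw [hminx, Polynomial.Separable, hderx]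
      exact isCoprime_one_right
    · rw [hminx, hderx, map_one]
    · exact hc.tower_top
  clear hc
  induction hcx using Algebra.adjoin_induction with
  | mem w hw => exact Algebra.subset_adjoin (by simp [Set.mem_singleton_iff.1 hw])
  | add _ _ _ _ h1 h2 => exact add_mem h1 h2
  | mul _ _ _ _ h1 h2 => exact mul_mem h1 h2
  | algebraMap a =>
    have ha : (a : L) ∈ Algebra.adjoin A {Bz.gen} :=
      Bz.mem_adjoin_of_pow_squarefree hm hmA hD hD0 hminz a.2
    have h1 : algebraMap L C a ∈ (Algebra.adjoin A {Bz.gen}).map (IsScalarTower.toAlgHom A L C) :=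
      ⟨a, ha, rfl⟩
    rw [AlgHom.map_adjoin, Set.image_singleton, hBz] at h1
    refine Algebra.adjoin_mono ?_ h1
    simp

end normality

/-! ### `k[x, y, z]` as the ring of functions regular away from the pole -/

section poles

open Polynomial

variable {k C : Type*} [Field k] [Field C] [Algebra k C] {q m : ℕ} {x y z : C}

/-- The tower result with `A = k[X]`, where `X` acts as `y`. The radicand `X ^ q ^ 2 - X` is
squarefree because its derivative is `-1`. -/
theorem mem_adjoin_of_isIntegral (hq : 2 ≤ q) (hm : 0 < m) (hqm : q.Coprime m)
    (hqk : (q : k) = 0) (hmk : (m : k) = 1)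
    (htop : IntermediateField.adjoin k {x, y, z} = ⊤)
    (hxy : x ^ q + x = y ^ (q + 1)) (hyz : z ^ m = y ^ q ^ 2 - y)
    {P : ValuationSubring C} (hk : ∀ c : k, algebraMap k C c ∈ P) (hy : y ∉ P)
    (K : Type*) [Field K] [Algebra k[X] K] [IsFractionRing k[X] K] [Algebra k[X] C] [Algebra K C]
    [IsScalarTower k[X] K C] [Algebra k K] [IsScalarTower k K C]
    (hal : ∀ f : k[X], algebraMap k[X] C f = aeval y f)
    {c : C} (hint : IsIntegral k[X] c) : c ∈ Algebra.adjoin k {x, y, z} := by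
  have hqA : (q : k[X]) = 0 := by rw [← map_natCast (Polynomial.C), hqk, map_zero]
  have hmA : (m : k[X]) = 1 := by rw [← map_natCast (Polynomial.C), hmk, map_one]
  have hder : derivative (X ^ q ^ 2 - X : k[X]) = -1 := by
    simp [derivative_X_pow, hqk]
  have hsqf : Squarefree (X ^ q ^ 2 - X : k[X]) := by
    refine Separable.squarefree ?_
    rw [Polynomial.Separable, hder]
    exact isCoprime_one_right.neg_right
  have hli : LinearIndependent K
      (fun i : Fin q × Fin m => x ^ (i.1 : ℕ) * z ^ (i.2 : ℕ)) := by
    rw [← LinearIndependent.iff_fractionRing k[X], Fintype.linearIndependent_iff]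
    intro f hf
    let F : ℕ → k[X][X] := fun i =>
      if h : i < q then ∑ l : Fin m, monomial (l : ℕ) (f (⟨i, h⟩, l)) else 0
    have hFd : ∀ i (h : i < q), F i = ∑ l : Fin m, monomial (l : ℕ) (f (⟨i, h⟩, l)) :=
      fun i h => dif_pos h
    have hF := eq_zero_of_sum_gkEval_eq_zero hq hm hqm hxy hyz hk hy F (by
        intro i hi
        rw [hFd i hi]
        refine lt_of_le_of_lt (natDegree_sum_le_of_forall_le (n := m - 1) _ _ fun l _ => ?_)
          (Nat.sub_lt hm one_pos)
        exact (natDegree_monomial_le _).trans (by omega)) (by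
        rw [← hf, Finset.sum_range, Fintype.sum_prod_type]
        refine Finset.sum_congr rfl fun i _ => ?_
        rw [hFd i i.2, map_sum, Finset.mul_sum]
        refine Finset.sum_congr rfl fun l _ => ?_
        rw [← C_mul_X_pow_eq_monomial, map_mul, map_pow, gkEval_X, gkEval_C, Algebra.smul_def, hal]
        simp only [Fin.eta]
        ring)
    rintro ⟨i, l⟩
    have h1 := congrArg (fun p => p.coeff (l : ℕ)) (hF i i.2)
    simp only [hFd i i.2, finsetSum_coeff, coeff_monomial, coeff_zero, Fin.eta] at h1
    simpa [Fin.val_inj] using h1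
  have htop' : IntermediateField.adjoin K {x, z} = ⊤ := by
    rw [← IntermediateField.restrictScalars_eq_top_iff (K := k), eq_top_iff, ← htop,
      IntermediateField.adjoin_le_iff]
    intro w hw
    rw [SetLike.mem_coe, IntermediateField.mem_restrictScalars]
    rcases hw with rfl | rfl | rfl
    · exact IntermediateField.subset_adjoin _ _ (by simp)
    · have : algebraMap K C (algebraMap k[X] _ X) = w := by
        rw [← IsScalarTower.algebraMap_apply, hal, aeval_X]
      rw [← this]
      exact (IntermediateField.adjoin K {x, z}).algebraMap_mem _
    · exact IntermediateField.subset_adjoin _ _ (by simp)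
  have := mem_adjoin_of_isIntegral_of_tower K hq hm hqA hmA
    (b := X ^ (q + 1)) (D := X ^ q ^ 2 - X) (by simp [hal, hxy]) (by simp [hal, hyz]) hsqf
    hsqf.ne_zero hli htop' hint
  clear hint
  induction this using Algebra.adjoin_induction with
  | mem w hw =>
    refine Algebra.subset_adjoin ?_
    rcases hw with rfl | rfl <;> simp
  | add _ _ _ _ h1 h2 => exact add_mem h1 h2
  | mul _ _ _ _ h1 h2 => exact mul_mem h1 h2
  | algebraMap f =>
    rw [hal]
    exact Algebra.adjoin_mono (by simp) (aeval_mem_adjoin_singleton k y)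

/-- `k[x, y, z]` is the ring of functions without poles outside the poles of `y`. -/
theorem mem_adjoin_of_forall_mem_valuationSubring (hq : 2 ≤ q) (hm : 0 < m) (hqm : q.Coprime m)
    (hqk : (q : k) = 0) (hmk : (m : k) = 1)
    (htop : IntermediateField.adjoin k {x, y, z} = ⊤)
    (hxy : x ^ q + x = y ^ (q + 1)) (hyz : z ^ m = y ^ q ^ 2 - y)
    {P : ValuationSubring C} (hk : ∀ c : k, algebraMap k C c ∈ P) (hy : y ∉ P)
    {c : C} (hc : ∀ V : ValuationSubring C, (∀ a : k, algebraMap k C a ∈ V) → y ∈ V → c ∈ V) :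
    c ∈ Algebra.adjoin k {x, y, z} := by
  let : Algebra k[X] C := (aeval (R := k) y).toAlgebra
  have hal : ∀ f : k[X], algebraMap k[X] C f = aeval y f := fun f => rfl
  have hF0 : ∀ f : k[X], aeval y f = 0 → f = 0 := by
    intro f hf
    have := eq_zero_of_sum_gkEval_eq_zero hq hm hqm hxy hyz hk hy
      (fun i => if i = 0 then Polynomial.C f else 0) (by
        intro i _; split_ifs <;> simpa using hm) (by
        rw [Finset.sum_eq_single_of_mem 0 (Finset.mem_range.2 (by omega))]
        · simpa using hf
        · intro i _ hi; simp [hi]) 0 (by omega)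
    simpa using this
  have hinj : Function.Injective (algebraMap k[X] C) :=
    (injective_iff_map_eq_zero _).2 fun f hf => hF0 f hf
  have : FaithfulSMul k[X] C := (faithfulSMul_iff_algebraMap_injective _ _).2 hinj
  let : Algebra (FractionRing k[X]) C := FractionRing.liftAlgebra k[X] C
  have : IsScalarTower k[X] (FractionRing k[X]) C := FractionRing.isScalarTower_liftAlgebra k[X] C
  have : IsScalarTower k k[X] C := IsScalarTower.of_algebraMap_eq fun a => by
    rw [hal]; simp
  have : IsScalarTower k (FractionRing k[X]) C := IsScalarTower.of_algebraMap_eq fun a => by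
    rw [IsScalarTower.algebraMap_apply k k[X] (FractionRing k[X]),
      ← IsScalarTower.algebraMap_apply k[X], ← IsScalarTower.algebraMap_apply k k[X]]
  -- The integral closure of `k[y]` in `C` is an intersection of valuation rings, and each valuation
  -- ring used contains `k` and `y`.
  have hint : IsIntegral k[X] c := by
    by_contra h
    have h' : c ∉ (integralClosure k[X] C).toSubring := h
    have : IsIntegrallyClosedIn (integralClosure k[X] C).toSubring C :=
      inferInstanceAs (IsIntegrallyClosedIn (integralClosure k[X] C) C)
    obtain ⟨V, hV, hcV⟩ := Subring.exists_le_valuationSubring_of_isIntegrallyClosedIn h'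
    refine hcV (hc V (fun a => hV ?_) (hV ?_))
    · exact (IsScalarTower.algebraMap_apply k k[X] C a).symm ▸
        (integralClosure k[X] C).algebraMap_mem (algebraMap k k[X] a)
    · have : algebraMap k[X] C X = y := by rw [hal, aeval_X]
      exact this ▸ (integralClosure k[X] C).algebraMap_mem X
  exact mem_adjoin_of_isIntegral hq hm hqm hqk hmk htop hxy hyz hk hy (FractionRing k[X]) hal hint

end poles

/-! ### The stabilizer of the pole preserves `k[x, y, z]` and pole orders -/

section stabilizer

variable {k C : Type*} [Field k] [Field C] [Algebra k C] {q m : ℕ} {x y z : C}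

theorem ValuationSubring.mem_of_pow_add_mem {V : ValuationSubring C} (hq : 2 ≤ q)
    (h : x ^ q + x ∈ V) : x ∈ V := by
  by_contra hx
  have hx1 : 1 < V.valuation x := by
    rw [← not_le]; exact fun h => hx ((V.valuation_le_one_iff x).1 h)
  have h1 := (V.valuation_le_one_iff _).2 h
  rw [V.valuation.map_add_eq_of_lt_left, map_pow] at h1
  · exact absurd h1 (not_le.2 (one_lt_pow' hx1 (by omega)))
  · rw [map_pow]; exact lt_self_pow₀ hx1 hq

theorem ValuationSubring.mem_of_pow_mem {V : ValuationSubring C} (hm : 0 < m)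
    (h : z ^ m ∈ V) : z ∈ V := by
  by_contra hz
  have hz1 : 1 < V.valuation z := by
    rw [← not_le]; exact fun h => hz ((V.valuation_le_one_iff z).1 h)
  have h1 := (V.valuation_le_one_iff _).2 h
  rw [map_pow] at h1
  exact absurd h1 (not_le.2 (one_lt_pow' hz1 hm.ne'))

theorem adjoin_le_valuationSubring {V : ValuationSubring C} (hq : 2 ≤ q) (hm : 0 < m)
    (hxy : x ^ q + x = y ^ (q + 1)) (hyz : z ^ m = y ^ q ^ 2 - y)
    (hk : ∀ c : k, algebraMap k C c ∈ V) (hy : y ∈ V) {r : C}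
    (hr : r ∈ Algebra.adjoin k {x, y, z}) : r ∈ V := by
  induction hr using Algebra.adjoin_induction with
  | mem w hw =>
    rcases hw with rfl | rfl | rfl
    · exact ValuationSubring.mem_of_pow_add_mem hq (hxy ▸ pow_mem hy _)
    · exact hy
    · exact ValuationSubring.mem_of_pow_mem hm (hyz ▸ sub_mem (pow_mem hy _) hy)
  | algebraMap c => exact hk c
  | add _ _ _ _ h1 h2 => exact add_mem h1 h2
  | mul _ _ _ _ h1 h2 => exact mul_mem h1 h2

theorem ValuationSubring.apply_mem_iff_of_smul_eq {V : ValuationSubring C} {g : C ≃ₐ[k] C}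
    (hg : g • V = V) (c : C) : g c ∈ V ↔ c ∈ V := by
  conv_lhs => rw [← hg]
  exact ValuationSubring.smul_mem_pointwise_smul_iff

/-- By uniqueness of the pole, `g` permutes the valuation rings over `k` that contain `y`; `k[x, y,
z]` is their intersection. -/
theorem apply_mem_adjoin (hq : 2 ≤ q) (hm : 0 < m) (hqm : q.Coprime m)
    (hqk : (q : k) = 0) (hmk : (m : k) = 1)
    (htop : IntermediateField.adjoin k {x, y, z} = ⊤)
    (hxy : x ^ q + x = y ^ (q + 1)) (hyz : z ^ m = y ^ q ^ 2 - y)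
    {P : ValuationSubring C} (hk : ∀ c : k, algebraMap k C c ∈ P) (hy : y ∉ P)
    {g : C ≃ₐ[k] C} (hg : g • P = P) {r : C} (hr : r ∈ Algebra.adjoin k {x, y, z}) :
    g r ∈ Algebra.adjoin k {x, y, z} := by
  refine mem_adjoin_of_forall_mem_valuationSubring hq hm hqm hqk hmk htop hxy hyz hk hy ?_
  intro V hV hyV
  have hV' : ∀ c : k, algebraMap k C c ∈ g⁻¹ • V := fun c => by
    rw [ValuationSubring.mem_inv_pointwise_smul_iff, AlgEquiv.smul_def, AlgEquiv.commutes]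
    exact hV c
  have hyV' : y ∈ g⁻¹ • V := by
    by_contra h
    have := pole_unique hq hm hqm htop hxy hyz hk hy hV' h
    rw [← hg, this, smul_inv_smul] at hy
    exact hy hyV
  have := adjoin_le_valuationSubring hq hm hxy hyz hV' hyV' hr
  rwa [ValuationSubring.mem_inv_pointwise_smul_iff] at this

theorem valuation_apply_lt {P : ValuationSubring C} {g : C ≃ₐ[k] C} (hg : g • P = P) {a b : C}
    (h : P.valuation a < P.valuation b) : P.valuation (g a) < P.valuation (g b) := by
  have ha : a ≠ 0 ∨ a = 0 := (ne_or_eq a 0)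
  have hb : b ≠ 0 := by rintro rfl; simp at h
  rcases ha with ha | rfl
  · rw [← not_le] at h ⊢
    contrapose! h
    have hga : P.valuation (g a) ≠ 0 := by simpa using ha
    have ha' : P.valuation a ≠ 0 := by simpa using ha
    rw [← div_le_one₀ (zero_lt_iff.2 hga), ← map_div₀, ← map_div₀,
      ValuationSubring.valuation_le_one_iff, ValuationSubring.apply_mem_iff_of_smul_eq hg] at h
    rwa [← div_le_one₀ (zero_lt_iff.2 ha'), ← map_div₀, ValuationSubring.valuation_le_one_iff]
  · simpa [zero_lt_iff] using hb

/-- An automorphism that fixes the pole of `y` preserves pole orders. -/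
theorem valuation_apply_eq (hq : 2 ≤ q) (hm : 0 < m) (hqm : q.Coprime m)
    (hqk : (q : k) = 0) (hmk : (m : k) = 1)
    (htop : IntermediateField.adjoin k {x, y, z} = ⊤)
    (hxy : x ^ q + x = y ^ (q + 1)) (hyz : z ^ m = y ^ q ^ 2 - y)
    {P : ValuationSubring C} (hk : ∀ c : k, algebraMap k C c ∈ P) (hy : y ∉ P)
    {g : C ≃ₐ[k] C} (hg : g • P = P) {r : C} (hr : r ∈ Algebra.adjoin k {x, y, z}) :
    P.valuation (g r) = P.valuation r := by
  obtain ⟨T, hT, hTi⟩ := exists_valuation_gkMono hq hm hqm hxy hyz hy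
  have hpow : ∀ r ∈ Algebra.adjoin k {x, y, z}, r ≠ 0 → ∃ d : ℕ, P.valuation r = T ^ d :=
    fun r hr hr0 => by
      obtain ⟨d, hd⟩ := exists_valuation_eq_pow (k := k) hq hm hqm hxy hyz hr hr0
      exact ⟨d, hd P hk T hT hTi⟩
  -- Infinite descent: if `g` lowered the pole order of `r`, it would also lower that of `g r`, and
  -- so on. The reverse inequality comes from `g⁻¹`.
  have key : ∀ g : C ≃ₐ[k] C, g • P = P → ∀ d : ℕ, ∀ r ∈ Algebra.adjoin k {x, y, z}, r ≠ 0 →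
      P.valuation r = T ^ d → P.valuation r ≤ P.valuation (g r) := by
    intro g hg d
    induction d using Nat.strong_induction_on with
    | _ d ih =>
      intro r hr hr0 hrd
      by_contra! h
      have hgr := apply_mem_adjoin hq hm hqm hqk hmk htop hxy hyz hk hy hg hr
      have hgr0 : g r ≠ 0 := by simpa using hr0
      obtain ⟨d', hd'⟩ := hpow _ hgr hgr0
      have hlt : d' < d := by
        rw [hrd, hd'] at h
        exact (pow_lt_pow_iff_right₀ hT).1 h
      exact absurd (ih d' hlt _ hgr hgr0 hd') (not_le.2 (valuation_apply_lt hg h))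
  rcases eq_or_ne r 0 with rfl | hr0
  · simp
  refine le_antisymm ?_ ?_
  · have hgr := apply_mem_adjoin hq hm hqm hqk hmk htop hxy hyz hk hy hg hr
    have hgr0 : g r ≠ 0 := by simpa using hr0
    obtain ⟨d', hd'⟩ := hpow _ hgr hgr0
    have hg' : g⁻¹ • P = P := by rw [inv_smul_eq_iff, hg]
    have := key g⁻¹ hg' d' _ hgr hgr0 hd'
    rwa [show g⁻¹ (g r) = r from g.symm_apply_apply r] at this
  · obtain ⟨d, hd⟩ := hpow _ hr hr0
    exact key g hg d r hr hr0 hd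

end stabilizer

/-! ### The images of the generators -/

section form

open Polynomial

variable {k C : Type*} [Field k] [Field C] [Algebra k C] {q m : ℕ} {x y z : C}

/-- Used for `g y`. Only `y` and the powers `z ^ l` with `l * q ^ 3 ≤ q * m` have weight at most
that of `y`. -/
theorem exists_of_mem_span_wt_y (hq : 2 ≤ q) (hm : 0 < m) {r : C}
    (hr : r ∈ Submodule.span k (gkMono x y z '' {i ∈ gkIdx q m | gkWt q m i ≤ q * m})) :
    ∃ (a : k) (u : k[X]), r = algebraMap k C a * y + aeval z u ∧ u.natDegree < m ∧
      q ^ 2 * u.natDegree ≤ m := by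
  induction hr using Submodule.span_induction with
  | mem r hr =>
    obtain ⟨⟨i, j, l⟩, ⟨⟨hi, hl⟩, hw⟩, rfl⟩ := hr
    simp only [gkWt] at hi hl hw
    have hi0 : i = 0 := by
      by_contra h
      have : (q + 1) * m ≤ i * ((q + 1) * m) := Nat.le_mul_of_pos_left _ (Nat.pos_of_ne_zero h)
      have : (q + 1) * m = q * m + m := by ring
      omega
    have hqm : 0 < q * m := by positivity
    have hj : j ≤ 1 := by
      by_contra! h
      have : 2 * (q * m) ≤ j * (q * m) := Nat.mul_le_mul_right _ h
      omega
    subst hi0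
    interval_cases j
    · refine ⟨0, X ^ l, by simp [gkMono], by simpa using hl, ?_⟩
      rw [natDegree_X_pow]
      refine Nat.le_of_mul_le_mul_left (?_ : q * (q ^ 2 * l) ≤ q * m) (by omega)
      calc q * (q ^ 2 * l) = l * q ^ 3 := by ring
        _ ≤ q * m := by omega
    · have : l * q ^ 3 = 0 := by omega
      have hl0 : l = 0 := by
        rcases Nat.mul_eq_zero.1 this with h | h
        · exact h
        · exact absurd h (pow_ne_zero _ (by omega))
      subst hl0
      exact ⟨1, 0, by simp [gkMono], by simpa using hm, by simp⟩
  | zero => exact ⟨0, 0, by simp, by simpa using hm, by simp⟩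
  | add r s _ _ h1 h2 =>
    obtain ⟨a, u, rfl, hu, hu'⟩ := h1
    obtain ⟨b, w, rfl, hw, hw'⟩ := h2
    refine ⟨a + b, u + w, by simp; ring, ?_, ?_⟩
    · exact (natDegree_add_le u w).trans_lt (max_lt hu hw)
    · refine (Nat.mul_le_mul_left _ (natDegree_add_le u w)).trans ?_
      rcases max_choice u.natDegree w.natDegree with h | h <;> rw [h] <;> assumption
  | smul c r _ h =>
    obtain ⟨a, u, rfl, hu, hu'⟩ := h
    refine ⟨c * a, c • u, by simp [Algebra.smul_def]; ring, ?_, ?_⟩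
    · exact (natDegree_smul_le c u).trans_lt hu
    · exact (Nat.mul_le_mul_left _ (natDegree_smul_le c u)).trans hu'

/-- Used for `g z`. By `hm3` the weight of `x` exceeds that of `z`, and so do those of `y ^ 2` and
`y * z`. -/
theorem exists_of_mem_span_wt_z (hq : 2 ≤ q) (hm3 : q ^ 3 < (q + 1) * m) {r : C}
    (hr : r ∈ Submodule.span k (gkMono x y z '' {i ∈ gkIdx q m | gkWt q m i ≤ q ^ 3})) :
    ∃ (a b c : k), r = algebraMap k C a * z + algebraMap k C b * y + algebraMap k C c := by
  induction hr using Submodule.span_induction with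
  | mem r hr =>
    obtain ⟨⟨i, j, l⟩, ⟨⟨hi, hl⟩, hw⟩, rfl⟩ := hr
    simp only [gkWt] at hi hl hw
    have hm : 0 < m := Nat.pos_of_ne_zero (by rintro rfl; simp at hm3)
    have hi0 : i = 0 := by
      by_contra h
      have : (q + 1) * m ≤ i * ((q + 1) * m) := Nat.le_mul_of_pos_left _ (Nat.pos_of_ne_zero h)
      omega
    have hqm : q ^ 3 < 2 * (q * m) := by nlinarith
    have hq3 : 0 < q ^ 3 := by positivity
    have hj : j ≤ 1 := by
      by_contra! h
      have : 2 * (q * m) ≤ j * (q * m) := Nat.mul_le_mul_right _ h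
      omega
    have hl1 : l ≤ 1 := by
      by_contra! h
      have : 2 * q ^ 3 ≤ l * q ^ 3 := Nat.mul_le_mul_right _ h
      omega
    subst hi0
    interval_cases j <;> interval_cases l
    · exact ⟨0, 0, 1, by simp [gkMono]⟩
    · exact ⟨1, 0, 0, by simp [gkMono]⟩
    · exact ⟨0, 1, 0, by simp [gkMono]⟩
    · have : 0 < q * m := by positivity
      omega
  | zero => exact ⟨0, 0, 0, by simp⟩
  | add r s _ _ h1 h2 =>
    obtain ⟨a, b, c, rfl⟩ := h1
    obtain ⟨a', b', c', rfl⟩ := h2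
    exact ⟨a + a', b + b', c + c', by simp; ring⟩
  | smul d r _ h =>
    obtain ⟨a, b, c, rfl⟩ := h
    exact ⟨d * a, d * b, d * c, by simp [Algebra.smul_def]; ring⟩

/-- Used for `g x`. The strict bounds come from `q + 1 < q ^ 2`; they keep `u ^ q` and `w ^ q` of
degree below `m` in `z`, so that no reduction by `z ^ m` interferes later. -/
theorem exists_of_mem_span_wt_x (hq : 2 ≤ q) (hm : 0 < m) {r : C}
    (hr : r ∈ Submodule.span k (gkMono x y z '' {i ∈ gkIdx q m | gkWt q m i ≤ (q + 1) * m})) :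
    ∃ (a : k) (u w : k[X]), r = algebraMap k C a * x + aeval z u + y * aeval z w ∧
      q * u.natDegree < m ∧ q * w.natDegree < m := by
  induction hr using Submodule.span_induction with
  | mem r hr =>
    obtain ⟨⟨i, j, l⟩, ⟨⟨hi, hl⟩, hw⟩, rfl⟩ := hr
    simp only [gkWt] at hi hl hw
    have hqm : m < q * m := by nlinarith
    have hq1 : (q + 1) * m = q * m + m := by ring
    have hi1 : i ≤ 1 := by
      by_contra! h
      have : 2 * ((q + 1) * m) ≤ i * ((q + 1) * m) := Nat.mul_le_mul_right _ h
      omega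
    have hj1 : j ≤ 1 := by
      by_contra! h
      have : 2 * (q * m) ≤ j * (q * m) := Nat.mul_le_mul_right _ h
      omega
    have hql : q * l < m := by
      by_contra! h
      have h1 : l * q ^ 3 ≤ (q + 1) * m := by omega
      have h2 : q ^ 2 * m ≤ q ^ 2 * (q * l) := Nat.mul_le_mul_left _ h
      have h3 : q ^ 2 * (q * l) = l * q ^ 3 := by ring
      have h4 : q ^ 2 * m ≤ (q + 1) * m := by omega
      have h5 := Nat.le_of_mul_le_mul_right h4 hm
      nlinarith
    have hX : q * (X ^ l : k[X]).natDegree < m := by rwa [natDegree_X_pow]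
    interval_cases i
    · interval_cases j
      · exact ⟨0, X ^ l, 0, by simp [gkMono], hX, by simpa using hm⟩
      · exact ⟨0, 0, X ^ l, by simp [gkMono], by simpa using hm, hX⟩
    · have hj0 : j * (q * m) = 0 := by omega
      have hl0 : l * q ^ 3 = 0 := by omega
      have hj0' : j = 0 := (Nat.mul_eq_zero.1 hj0).resolve_right (by positivity)
      have hl0' : l = 0 := (Nat.mul_eq_zero.1 hl0).resolve_right (by positivity)
      subst hj0' hl0'
      exact ⟨1, 0, 0, by simp [gkMono], by simpa using hm, by simpa using hm⟩
  | zero => exact ⟨0, 0, 0, by simp, by simpa using hm, by simpa using hm⟩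
  | add r s _ _ h1 h2 =>
    obtain ⟨a, u, w, rfl, hu, hw⟩ := h1
    obtain ⟨a', u', w', rfl, hu', hw'⟩ := h2
    refine ⟨a + a', u + u', w + w', by simp; ring, ?_, ?_⟩
    · refine (Nat.mul_le_mul_left _ (natDegree_add_le u u')).trans_lt ?_
      rcases max_choice u.natDegree u'.natDegree with h | h <;> rw [h] <;> assumption
    · refine (Nat.mul_le_mul_left _ (natDegree_add_le w w')).trans_lt ?_
      rcases max_choice w.natDegree w'.natDegree with h | h <;> rw [h] <;> assumption
  | smul c r _ h =>
    obtain ⟨a, u, w, rfl, hu, hw⟩ := h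
    refine ⟨c * a, c • u, c • w, by simp [Algebra.smul_def]; ring, ?_, ?_⟩
    · exact (Nat.mul_le_mul_left _ (natDegree_smul_le c u)).trans_lt hu
    · exact (Nat.mul_le_mul_left _ (natDegree_smul_le c w)).trans_lt hw

end form

section form

open Polynomial

variable {k C : Type*} [Field k] [Field C] [Algebra k C] {p e q m : ℕ} {x y z : C}

/-- For nonconstant `u`, the coefficient of `u ^ q` at `q * u.natDegree` is a nonzero power of the
leading coefficient. Only this index matters; the last alternative of the hypothesis is vacuous at
every other one. -/
theorem eq_C_of_coeff_pow_sub_eq_zero {q : ℕ} (hq : 2 ≤ q) {u : k[X]}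
    (h : ∀ l, 0 < l → (u ^ q).coeff l = 0 ∨ u.natDegree < l ∧ (u ^ q).coeff l = 0 ∨
      (l = q * u.natDegree → (u ^ q).coeff l = 0)) :
    ∃ c, u = Polynomial.C c := by
  refine ⟨u.coeff 0, eq_C_of_natDegree_eq_zero ?_⟩
  by_contra h0
  have hd : 0 < q * u.natDegree := Nat.mul_pos (by omega) (Nat.pos_of_ne_zero h0)
  have h1 : (u ^ q).coeff (q * u.natDegree) = 0 := by
    rcases h _ hd with h | h | h
    exacts [h, h.2, h rfl]
  rw [← natDegree_pow] at h1
  have := leadingCoeff_eq_zero.1 h1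
  exact h0 (by simp [eq_zero_of_pow_eq_zero this])

variable [hp : Fact p.Prime] [CharP k p]

/-- The relation `z ^ m = y ^ q ^ 2 - y` forces the image of `y` to be affine in `y`. -/
theorem exists_eq_C_of_kummer_relation (he : 0 < e) (hqe : q = p ^ e) (hm : 2 ≤ m) (hqm : q.Coprime m)
    (hmk : (m : k) = 1) (hdvd : ¬ q ^ 2 ∣ m - 1)
    (hxy : x ^ q + x = y ^ (q + 1)) (hyz : z ^ m = y ^ q ^ 2 - y)
    {P : ValuationSubring C} (hk : ∀ c : k, algebraMap k C c ∈ P) (hy : y ∉ P)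
    {ζ b c a : k} (hζ : ζ ≠ 0) {u : k[X]} (hu : q ^ 2 * u.natDegree ≤ m)
    (h : (algebraMap k C ζ * z + algebraMap k C b * y + algebraMap k C c) ^ m
      = (algebraMap k C a * y + aeval z u) ^ q ^ 2 - (algebraMap k C a * y + aeval z u)) :
    ∃ d, u = Polynomial.C d := by
  have hq : 2 ≤ q := hqe ▸ hp.out.two_le.trans (Nat.le_self_pow he.ne' p)
  have hq0 : 0 < q := by omega
  have : CharP C p := charP_of_injective_algebraMap (algebraMap k C).injective p
  have hadd : ∀ s t : C, (s + t) ^ q = s ^ q + t ^ q := fun s t => by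
    rw [hqe, add_pow_char_pow]
  have hmC : (m : k[X]) = 1 := by rw [← map_natCast (Polynomial.C), hmk, map_one]
  set W : k[X] := Polynomial.C (ζ⁻¹ * b) * X + Polynomial.C (ζ⁻¹ * c) with hW
  set G : k[X] := Polynomial.C (ζ ^ m) * (X ^ q ^ 2 - X)
    - (Polynomial.C (a ^ q ^ 2) * X ^ q ^ 2 - Polynomial.C a * X) with hG
  -- With `g z = ζ * (z + W(y))` and `z ^ m` replaced by `y ^ q ^ 2 - y`, the relation becomes
  -- `F0(y, z) = 0` with `F0` of degree below `m` in `z`; by independence `F0 = 0`.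
  set F0 : k[X][X] := Polynomial.C (Polynomial.C (ζ ^ m)) * ((X + Polynomial.C W) ^ m - X ^ m)
    + Polynomial.C G - (u ^ q ^ 2 - u).map Polynomial.C with hF0
  have hudeg : q ^ 2 * u.natDegree < m := by
    refine lt_of_le_of_ne hu fun h => ?_
    have : q ∣ m := ⟨q * u.natDegree, by rw [← h]; ring⟩
    have := Nat.Coprime.eq_one_of_dvd hqm this
    omega
  have hqd : u.natDegree ≤ q ^ 2 * u.natDegree := Nat.le_mul_of_pos_left _ (by positivity)
  have h4 : 4 * u.natDegree ≤ q ^ 2 * u.natDegree := Nat.mul_le_mul_right _ (by nlinarith)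
  have hdeg1 : ((X + Polynomial.C W) ^ m - X ^ m : k[X][X]).natDegree < m := by
    have hmon := (monic_X_add_C W).pow m
    have hd : ((X + Polynomial.C W) ^ m : k[X][X]).degree = (X ^ m : k[X][X]).degree := by
      rw [degree_pow, degree_X_add_C, degree_X_pow]; simp
    have := degree_sub_lt_left hd hmon.ne_zero (by rw [hmon.leadingCoeff, (monic_X_pow m).leadingCoeff])
    rw [degree_pow, degree_X_add_C, nsmul_one] at this
    rcases eq_or_ne ((X + Polynomial.C W) ^ m - X ^ m : k[X][X]) 0 with h0 | h0
    · rw [h0, natDegree_zero]; omega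
    · exact (natDegree_lt_iff_degree_lt h0).2 this
  have hdeg2 : ((u ^ q ^ 2 - u).map (Polynomial.C : k →+* k[X])).natDegree < m := by
    refine natDegree_map_le.trans_lt ((natDegree_sub_le _ _).trans_lt (max_lt ?_ ?_))
    · rwa [natDegree_pow]
    · omega
  have hF0deg : F0.natDegree < m := by
    refine (natDegree_sub_le _ _).trans_lt (max_lt ?_ hdeg2)
    refine (natDegree_add_le _ _).trans_lt (max_lt ((natDegree_C_mul_le _ _).trans_lt hdeg1) ?_)
    rw [natDegree_C]; omega
  have hev : gkEval k y z F0 = 0 := by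
    have hz' : algebraMap k C ζ * z + algebraMap k C b * y + algebraMap k C c
        = algebraMap k C ζ * (z + aeval y W) := by
      have : algebraMap k C ζ ≠ 0 := by simpa using hζ
      simp only [hW, map_add, map_mul, aeval_C, aeval_X, map_inv₀]
      field_simp
      ring
    rw [hz', mul_pow, sq q, pow_mul, hadd, hadd, ← pow_mul, ← pow_mul, ← sq q, mul_pow] at h
    simp only [hF0, hG, map_add, map_sub, map_mul, map_pow, gkEval_C, gkEval_X, gkEval_map_C,
      aeval_C, aeval_X, Polynomial.map_sub, Polynomial.map_pow]
    linear_combination h - algebraMap k C ζ ^ m * hyz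
  have hF00 : F0 = 0 := by
    have := eq_zero_of_sum_gkEval_eq_zero hq (by omega) hqm hxy hyz hk hy
      (fun i => if i = 0 then F0 else 0) (by
        intro i _; split_ifs
        · exact hF0deg
        · simp; omega) (by
        rw [Finset.sum_eq_single_of_mem 0 (Finset.mem_range.2 (by omega))]
        · simpa using hev
        · intro i _ hi; simp [hi]) 0 (by omega)
    simpa using this
  have hcoeff : ∀ l, 0 < l → Polynomial.C (ζ ^ m) * (W ^ (m - l) * (m.choose l : k[X])
      - if l = m then 1 else 0) - Polynomial.C ((u ^ q ^ 2).coeff l - u.coeff l) = 0 := by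
    intro l hl
    have := congrArg (fun f => f.coeff l) hF00
    simp only [hF0, coeff_sub, coeff_add, coeff_C_mul, coeff_map, coeff_X_add_C_pow, coeff_X_pow,
      coeff_C, if_neg hl.ne', add_zero, coeff_zero] at this
    exact this
  -- Coefficient of `z ^ (m - 1)`: the binomial contributes `m * W = W`. The other side contributes
  -- nothing, since `u ^ q ^ 2` involves only powers of `z ^ q ^ 2`, `q ^ 2 ∤ m - 1`, and `u` has
  -- degree below `m - 1`.
  have hWm : W = 0 := by
    have h1 := hcoeff (m - 1) (by omega)
    have h2 : u.coeff (m - 1) = 0 := coeff_eq_zero_of_natDegree_lt (by omega)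
    have h3 : (u ^ q ^ 2).coeff (m - 1) = 0 := by
      rw [hqe, ← pow_mul p, ← map_iterateFrobenius_expand p, coeff_map,
        coeff_expand (pow_pos hp.out.pos _), if_neg (by rwa [pow_mul, ← hqe]), map_zero]
    rw [h2, h3, if_neg (by omega), show m - (m - 1) = 1 by omega, Nat.choose_symm (by omega),
      Nat.choose_one_right, hmC] at h1
    simpa [hζ] using h1
  refine eq_C_of_coeff_pow_sub_eq_zero (q := q ^ 2) (by nlinarith) fun l hl => ?_
  by_cases hlu : l = q ^ 2 * u.natDegree
  · left
    have h1 := hcoeff l hl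
    have h2 : u.coeff l = 0 := coeff_eq_zero_of_natDegree_lt (by
      rw [hlu] at hl ⊢
      have : 0 < u.natDegree := Nat.pos_of_mul_pos_left hl
      omega)
    rw [hWm, zero_pow (by omega), if_neg (by omega), h2] at h1
    simpa using h1
  · exact Or.inr (Or.inr fun h => absurd h hlu)

/-- The relation `x ^ q + x = y ^ (q + 1)` determines the image of `x`. -/
theorem eq_of_hermitian_relation (he : 0 < e) (hqe : q = p ^ e) (hm : 0 < m) (hqm : q.Coprime m)
    (hxy : x ^ q + x = y ^ (q + 1)) (hyz : z ^ m = y ^ q ^ 2 - y)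
    {P : ValuationSubring C} (hk : ∀ c : k, algebraMap k C c ∈ P) (hy : y ∉ P)
    {a b a' : k} {u w : k[X]} (hu : q * u.natDegree < m) (hw : q * w.natDegree < m)
    (h : (algebraMap k C a' * x + aeval z u + y * aeval z w) ^ q
      + (algebraMap k C a' * x + aeval z u + y * aeval z w)
      = (algebraMap k C a * y + algebraMap k C b) ^ (q + 1)) :
    ∃ c, u = Polynomial.C c ∧ w = Polynomial.C (a * b ^ q) ∧ c ^ q + c = b ^ (q + 1) ∧ (a * b ^ q) ^ q = a ^ q * b ∧
      a' = a ^ (q + 1) ∧ a' ^ q = a' := by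
  have hq : 2 ≤ q := hqe ▸ hp.out.two_le.trans (Nat.le_self_pow he.ne' p)
  have hq0 : 0 < q := by omega
  have : CharP C p := charP_of_injective_algebraMap (algebraMap k C).injective p
  have hadd : ∀ s t : C, (s + t) ^ q = s ^ q + t ^ q := fun s t => by
    rw [hqe, add_pow_char_pow]
  set G : k[X] := Polynomial.C (a' ^ q - a ^ (q + 1)) * X ^ (q + 1)
    - Polynomial.C (a ^ q * b) * X ^ q
    - Polynomial.C (a * b ^ q) * X - Polynomial.C (b ^ (q + 1)) with hG
  -- Replacing `x ^ q` by `y ^ (q + 1) - x` turns the relation into `F0(y, z) + (a' - a' ^ q) * x =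
  -- 0`, where independence applies to both terms.
  set F0 : k[X][X] := (u ^ q + u).map Polynomial.C + Polynomial.C (X ^ q) * (w ^ q).map Polynomial.C
    + Polynomial.C X * w.map Polynomial.C + Polynomial.C G with hF0
  have hle : ∀ v : k[X], v.natDegree ≤ q * v.natDegree :=
    fun v => Nat.le_mul_of_pos_left _ (by positivity)
  have hpowdeg : ∀ v : k[X], q * v.natDegree < m →
      ((v ^ q).map (Polynomial.C : k →+* k[X])).natDegree < m := fun v hv =>
    natDegree_map_le.trans_lt (by rwa [natDegree_pow])
  have hF0deg : F0.natDegree < m := by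
    refine (natDegree_add_le _ _).trans_lt (max_lt ?_ (by rwa [natDegree_C]))
    refine (natDegree_add_le _ _).trans_lt (max_lt ?_ ?_)
    · refine (natDegree_add_le _ _).trans_lt (max_lt ?_ ?_)
      · rw [Polynomial.map_add]
        exact (natDegree_add_le _ _).trans_lt (max_lt (hpowdeg u hu)
          (natDegree_map_le.trans_lt ((hle u).trans_lt hu)))
      · exact (natDegree_C_mul_le _ _).trans_lt (hpowdeg w hw)
    · exact (natDegree_C_mul_le _ _).trans_lt (natDegree_map_le.trans_lt ((hle w).trans_lt hw))
  have hev : gkEval k y z F0 + x * algebraMap k C (a' - a' ^ q) = 0 := by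
    rw [pow_succ, hadd, hadd, hadd, mul_pow, mul_pow, mul_pow] at h
    simp only [hF0, hG, map_add, map_sub, map_mul, map_pow, gkEval_C, gkEval_map_C,
      aeval_C, aeval_X, Polynomial.map_add, Polynomial.map_pow]
    linear_combination h - algebraMap k C a' ^ q * hxy
  have hF := eq_zero_of_sum_gkEval_eq_zero hq hm hqm hxy hyz hk hy
      (fun i => if i = 0 then F0 else if i = 1 then
        Polynomial.C (Polynomial.C (a' - a' ^ q)) else 0) (by
        intro i _; split_ifs
        · exact hF0deg
        · rwa [natDegree_C]
        · rwa [natDegree_zero]) (by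
        rw [← Finset.sum_subset (Finset.range_subset_range.2 hq)]
        · rw [Finset.sum_range_succ, Finset.sum_range_one]
          simpa using hev
        · intro i _ hi
          rw [Finset.mem_range] at hi
          rw [if_neg (by omega), if_neg (by omega)]
          simp)
  have hF00 : F0 = 0 := by simpa using hF 0 (by omega)
  have hF1 : a' - a' ^ q = 0 := by
    have := hF 1 (by omega)
    rw [if_neg one_ne_zero, if_pos rfl] at this
    exact C_injective (C_injective (by rw [this, map_zero, map_zero]))
  -- The coefficient of `z ^ l * y ^ j`. For `l > 0` the exponents `j = 0` and `j = 1` isolate `u`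
  -- and `w`; for `l = 0` the exponents `0, 1, q, q + 1` give the conditions on the constants.
  have hcoeff : ∀ l j, ((u ^ q).coeff l + u.coeff l) * (if j = 0 then 1 else 0)
      + (w ^ q).coeff l * (if j = q then 1 else 0) + w.coeff l * (if j = 1 then 1 else 0)
      + (if l = 0 then G.coeff j else 0) = 0 := by
    intro l j
    have := congrArg (fun f => (f.coeff l).coeff j) hF00
    simp only [hF0, coeff_add, coeff_map, coeff_C_mul, coeff_C, coeff_zero] at this
    refine Eq.trans ?_ this
    have h1 : (X ^ q * Polynomial.C ((w ^ q).coeff l)).coeff j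
        = (w ^ q).coeff l * (if j = q then 1 else 0) := by
      rw [coeff_mul_C, coeff_X_pow, mul_comm]
    have h2 : (X * Polynomial.C (w.coeff l)).coeff j = w.coeff l * (if j = 1 then 1 else 0) := by
      rw [coeff_mul_C, coeff_X, mul_comm]; simp [eq_comm]
    rw [h1, h2]
    have h3 : (if l = 0 then G else 0).coeff j = if l = 0 then G.coeff j else 0 := by
      split_ifs <;> simp
    rw [h3]
    simp only [mul_ite, mul_one, mul_zero]
  have hGj : ∀ j, G.coeff j = (a' ^ q - a ^ (q + 1)) * (if j = q + 1 then 1 else 0)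
      - a ^ q * b * (if j = q then 1 else 0) - a * b ^ q * (if j = 1 then 1 else 0)
      - b ^ (q + 1) * (if j = 0 then 1 else 0) := by
    intro j
    simp only [hG, coeff_sub, coeff_C_mul, coeff_X_pow, coeff_X, coeff_C, mul_ite, mul_one,
      mul_zero, eq_comm (a := 1) (b := j)]
  obtain ⟨c, rfl⟩ : ∃ c, u = Polynomial.C c := by
    refine eq_C_of_coeff_pow_sub_eq_zero hq fun l hl => ?_
    by_cases hlu : l = q * u.natDegree
    · left
      have h1 := hcoeff l 0
      have h2 : u.coeff l = 0 := coeff_eq_zero_of_natDegree_lt (by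
        rw [hlu] at hl ⊢
        have : 0 < u.natDegree := Nat.pos_of_mul_pos_left hl
        nlinarith)
      rw [if_neg (show (0 : ℕ) ≠ q by omega), if_neg hl.ne', h2] at h1
      simpa using h1
    · exact Or.inr (Or.inr fun h => absurd h hlu)
  have hwC : w = Polynomial.C (w.coeff 0) := by
    ext l
    rcases Nat.eq_zero_or_pos l with rfl | hl
    · simp
    · have h1 := hcoeff l 1
      rw [if_neg one_ne_zero, if_neg (show 1 ≠ q by omega), if_neg hl.ne'] at h1
      rw [coeff_C, if_neg hl.ne']
      simpa using h1
  have c0 := hcoeff 0 0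
  have c1 := hcoeff 0 1
  have cq := hcoeff 0 q
  have cq1 := hcoeff 0 (q + 1)
  have n1 : (0 : ℕ) ≠ q := by omega
  have n2 : (1 : ℕ) ≠ q := by omega
  have n3 : (0 : ℕ) ≠ q + 1 := by omega
  have n4 : (1 : ℕ) ≠ q + 1 := by omega
  have n5 : q ≠ q + 1 := by omega
  simp only [hGj, if_neg n1, if_neg n2, if_neg n3, if_neg n4, if_neg n5, if_neg n1.symm,
    if_neg n2.symm, if_neg n3.symm, if_neg n4.symm, if_neg n5.symm, if_true, mul_one, mul_zero,
    if_neg zero_ne_one, if_neg one_ne_zero, ← C_pow, coeff_C_zero] at c0 c1 cq cq1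
  have hw0 : w.coeff 0 = a * b ^ q := by linear_combination c1
  rw [hwC, hw0, ← C_pow, coeff_C_zero] at cq
  have ha' : a' ^ q = a' := by linear_combination -hF1
  refine ⟨c, rfl, by rw [hwC, hw0], by linear_combination c0, by linear_combination cq, ?_, ha'⟩
  rw [← ha']
  linear_combination cq1

end form

/-! ### The places above the points of the Hermitian curve -/

section places

variable {k C : Type*} [Field k] [Field C] [Algebra k C] {q m : ℕ} {x y z : C} {α β : k}

/-- The graph of the evaluation `k[x, y, z] → k` at the point `(α, β, 0)`. -/
def gkGraph (x y z : C) (α β : k) : Subalgebra k (C × k) :=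
  Algebra.adjoin k {(x, α), (y, β), (z, 0)}

/-- Evaluation at the point is single-valued: `(α, β, 0)` satisfies the defining relations, so
elements of the graph are combinations of reduced monomials in `C × k`, and their first coordinates
are independent. -/
theorem eq_zero_of_zero_mem_gkGraph (hq : 2 ≤ q) (hm : 0 < m) (hqm : q.Coprime m)
    (hxy : x ^ q + x = y ^ (q + 1)) (hyz : z ^ m = y ^ q ^ 2 - y)
    {P : ValuationSubring C} (hk : ∀ c : k, algebraMap k C c ∈ P) (hy : y ∉ P)
    (hβ : β ^ q ^ 2 = β) (hαβ : α ^ q + α = β ^ (q + 1)) {c : k}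
    (h : ((0 : C), c) ∈ gkGraph x y z α β) : c = 0 := by
  obtain ⟨f, hf, hfc⟩ := exists_finsupp_of_mem_adjoin (q := q) (m := m) (x := (x, α)) (y := (y, β))
    (z := (z, (0 : k))) hq hm (Prod.ext hxy hαβ)
    (Prod.ext hyz (by simp [zero_pow hm.ne', hβ])) h
  have h1 := congrArg (LinearMap.fst k C k) hfc
  rw [Finsupp.linearCombination_apply, map_finsuppSum] at h1
  have hf0 : f = 0 := by
    refine linearCombination_gkMono_eq_zero hq hm hqm hxy hyz hk hy hf ?_
    rw [Finsupp.linearCombination_apply]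
    refine Eq.trans (Finsupp.sum_congr fun i _ => ?_) h1
    rw [map_smul]
    rfl
  rw [hf0, map_zero] at hfc
  exact (congrArg Prod.snd hfc).symm

theorem exists_mem_gkGraph {r : C} (hr : r ∈ Algebra.adjoin k {x, y, z}) :
    ∃ c, (r, c) ∈ gkGraph x y z α β := by
  induction hr using Algebra.adjoin_induction with
  | mem w hw =>
    rcases hw with rfl | rfl | rfl
    · exact ⟨α, Algebra.subset_adjoin (by simp)⟩
    · exact ⟨β, Algebra.subset_adjoin (by simp)⟩
    · exact ⟨0, Algebra.subset_adjoin (by simp)⟩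
  | algebraMap c => exact ⟨c, (gkGraph x y z α β).algebraMap_mem c⟩
  | add _ _ _ _ h1 h2 =>
    obtain ⟨c, h1⟩ := h1
    obtain ⟨d, h2⟩ := h2
    exact ⟨c + d, add_mem h1 h2⟩
  | mul _ _ _ _ h1 h2 =>
    obtain ⟨c, h1⟩ := h1
    obtain ⟨d, h2⟩ := h2
    exact ⟨c * d, mul_mem h1 h2⟩

theorem algebraMap_mem_gkGraph (c : k) : (algebraMap k C c, c) ∈ gkGraph x y z α β :=
  (gkGraph x y z α β).algebraMap_mem c

/-- The functions of `k[x, y, z]` that vanish at `(α, β, 0)`. -/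
def gkIdeal (x y z : C) (α β : k) : Ideal (Algebra.adjoin k {x, y, z}) where
  carrier := {r | ((r : C), (0 : k)) ∈ gkGraph x y z α β}
  add_mem' := fun {a b} ha hb => by
    have := (gkGraph x y z α β).add_mem ha hb
    simpa using this
  zero_mem' := (gkGraph x y z α β).zero_mem
  smul_mem' := fun r a ha => by
    obtain ⟨c, hc⟩ := exists_mem_gkGraph (α := α) (β := β) r.2
    have := (gkGraph x y z α β).mul_mem hc ha
    simpa using this

theorem mem_gkIdeal {r : Algebra.adjoin k {x, y, z}} :
    r ∈ gkIdeal x y z α β ↔ ((r : C), (0 : k)) ∈ gkGraph x y z α β := Iff.rfl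

/-- An element of `k[x, y, z]` is congruent to its value modulo `x - α`, `y - β` and `z`. -/
theorem mem_span_of_mem_gkIdeal (r : Algebra.adjoin k {x, y, z}) :
    ∃ c : k, ((r : C), c) ∈ gkGraph x y z α β ∧
      r - algebraMap k _ c ∈ Ideal.span
        {w : Algebra.adjoin k {x, y, z} | (w : C) = x - algebraMap k C α ∨
          (w : C) = y - algebraMap k C β ∨ (w : C) = z} := by
  obtain ⟨r, hr⟩ := r
  induction hr using Algebra.adjoin_induction with
  | mem w hw =>
    rcases hw with rfl | rfl | rfl
    · exact ⟨α, Algebra.subset_adjoin (by simp), Ideal.subset_span (Or.inl rfl)⟩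
    · exact ⟨β, Algebra.subset_adjoin (by simp), Ideal.subset_span (Or.inr (Or.inl rfl))⟩
    · exact ⟨0, Algebra.subset_adjoin (by simp), Ideal.subset_span (Or.inr (Or.inr (by simp)))⟩
  | algebraMap c =>
    refine ⟨c, algebraMap_mem_gkGraph c, ?_⟩
    convert Ideal.zero_mem _
    exact sub_self _
  | add a b ha hb h1 h2 =>
    obtain ⟨c, h1, h1'⟩ := h1
    obtain ⟨d, h2, h2'⟩ := h2
    refine ⟨c + d, add_mem h1 h2, ?_⟩
    convert add_mem h1' h2' using 1
    rw [map_add]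
    apply Subtype.ext
    push_cast
    ring
  | mul a b ha hb h1 h2 =>
    obtain ⟨c, h1, h1'⟩ := h1
    obtain ⟨d, h2, h2'⟩ := h2
    refine ⟨c * d, mul_mem h1 h2, ?_⟩
    convert add_mem (Ideal.mul_mem_left _ ⟨a, ha⟩ h2') (Ideal.mul_mem_left _ (algebraMap k _ d) h1')
      using 1
    rw [map_mul]
    apply Subtype.ext
    push_cast
    ring

theorem valuation_sub_lt_one_of_mem_gkGraph {Q : ValuationSubring C}
    (hk : ∀ c : k, algebraMap k C c ∈ Q) (hx : x - algebraMap k C α ∈ Q.nonunits)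
    (hy : y - algebraMap k C β ∈ Q.nonunits) (hz : z ∈ Q.nonunits) {r : C × k}
    (hr : r ∈ gkGraph x y z α β) : r.1 - algebraMap k C r.2 ∈ Q.nonunits := by
  have hmul : ∀ a ∈ Q, ∀ b ∈ Q.nonunits, a * b ∈ Q.nonunits := fun a ha b hb => by
    rw [ValuationSubring.mem_nonunits_iff] at hb ⊢
    rw [map_mul]
    exact (mul_le_of_le_one_left' ((Q.valuation_le_one_iff a).2 ha)).trans_lt hb
  induction hr using Algebra.adjoin_induction with
  | mem w hw =>
    rcases hw with rfl | rfl | rfl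
    · exact hx
    · exact hy
    · simpa using hz
  | algebraMap c =>
    convert zero_mem Q.nonunits
    exact sub_self _
  | add a b _ _ h1 h2 =>
    convert add_mem h1 h2 using 1
    simp only [Prod.fst_add, Prod.snd_add, map_add]
    ring
  | mul a b _ _ h1 h2 =>
    have ha : a.1 ∈ Q := by
      have := add_mem (Q.nonunits_subset h1) (hk a.2)
      simpa using this
    convert add_mem (hmul _ ha _ h2) (hmul _ (hk b.2) _ h1) using 1
    simp only [Prod.fst_mul, Prod.snd_mul, map_mul]
    ring

end places

section local_ring

variable {k C : Type*} [Field k] [Field C] [Algebra k C] {p e q m : ℕ} {x y z : C} {α β : k}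
variable [hp : Fact p.Prime] [CharP k p]

omit hp [CharP k p] in
theorem isPrime_gkIdeal (hq : 2 ≤ q) (hm : 0 < m) (hqm : q.Coprime m)
    (hxy : x ^ q + x = y ^ (q + 1)) (hyz : z ^ m = y ^ q ^ 2 - y)
    {P : ValuationSubring C} (hk : ∀ c : k, algebraMap k C c ∈ P) (hy : y ∉ P)
    (hβ : β ^ q ^ 2 = β) (hαβ : α ^ q + α = β ^ (q + 1)) :
    (gkIdeal x y z α β).IsPrime := by
  have hval : ∀ {r : C} {c d : k}, (r, c) ∈ gkGraph x y z α β → (r, d) ∈ gkGraph x y z α β →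
      c = d := fun {r c d} h1 h2 => by
    have := sub_mem h1 h2
    rw [Prod.mk_sub_mk, sub_self] at this
    exact sub_eq_zero.1 (eq_zero_of_zero_mem_gkGraph hq hm hqm hxy hyz hk hy hβ hαβ this)
  refine ⟨?_, ?_⟩
  · rw [Ideal.ne_top_iff_one, mem_gkIdeal]
    intro h
    exact zero_ne_one (hval h (gkGraph x y z α β).one_mem)
  · intro r s hrs
    obtain ⟨c, hc⟩ := exists_mem_gkGraph (α := α) (β := β) r.2
    obtain ⟨d, hd⟩ := exists_mem_gkGraph (α := α) (β := β) s.2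
    rw [mem_gkIdeal, mem_gkIdeal]
    have : c * d = 0 := hval (mul_mem hc hd) hrs
    rcases mul_eq_zero.1 this with rfl | rfl
    · exact Or.inl hc
    · exact Or.inr hd

omit hp [CharP k p] in
-- The functions vanishing at the point form a proper ideal, and some valuation ring contains `k[x,
-- y, z]` with this ideal among its nonunits.
theorem exists_valuationSubring_of_point (hq : 2 ≤ q) (hm : 0 < m) (hqm : q.Coprime m)
    (hxy : x ^ q + x = y ^ (q + 1)) (hyz : z ^ m = y ^ q ^ 2 - y)
    {P : ValuationSubring C} (hk : ∀ c : k, algebraMap k C c ∈ P) (hy : y ∉ P)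
    (hβ : β ^ q ^ 2 = β) (hαβ : α ^ q + α = β ^ (q + 1)) :
    ∃ Q : ValuationSubring C, (∀ c : k, algebraMap k C c ∈ Q) ∧
      x - algebraMap k C α ∈ Q.nonunits ∧ y - algebraMap k C β ∈ Q.nonunits := by
  have hprime := isPrime_gkIdeal hq hm hqm hxy hyz hk hy hβ hαβ
  obtain ⟨Q, hQ, hI⟩ := Ideal.image_subset_nonunits_valuationSubring
    (A := (Algebra.adjoin k {x, y, z}).toSubring) (gkIdeal x y z α β) hprime.ne_top
  have hmem : ∀ {w : C} {c : k}, w ∈ ({x, y, z} : Set C) → (w, c) ∈ gkGraph x y z α β →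
      w - algebraMap k C c ∈ Q.nonunits := fun {w c} hw hc => by
    refine hI ⟨⟨w - algebraMap k C c, sub_mem (Algebra.subset_adjoin hw)
      (Subalgebra.algebraMap_mem _ c)⟩, ?_, rfl⟩
    have := sub_mem hc (algebraMap_mem_gkGraph c)
    rwa [Prod.mk_sub_mk, sub_self] at this
  refine ⟨Q, fun c => hQ ((Algebra.adjoin k {x, y, z}).algebraMap_mem c), ?_, ?_⟩
  · exact hmem (by simp) (Algebra.subset_adjoin (by simp))
  · exact hmem (by simp) (Algebra.subset_adjoin (by simp))

/-- The local ring of `k[x, y, z]` at `(α, β, 0)` is a valuation ring, with uniformizer `z`. -/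
theorem valuationRing_localization_gkIdeal (he : 0 < e) (hqe : q = p ^ e)
    (hm : 0 < m) (hxy : x ^ q + x = y ^ (q + 1)) (hyz : z ^ m = y ^ q ^ 2 - y)
    (hβ : β ^ q ^ 2 = β) (hαβ : α ^ q + α = β ^ (q + 1))
    [hI : (gkIdeal x y z α β).IsPrime] :
    ValuationRing (Localization.AtPrime (gkIdeal x y z α β)) := by
  have hq : 2 ≤ q := hqe ▸ hp.out.two_le.trans (Nat.le_self_pow he.ne' p)
  have hCp : CharP C p := charP_of_injective_algebraMap (algebraMap k C).injective p
  set R := Algebra.adjoin k {x, y, z} with hR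
  set I := gkIdeal x y z α β with hIdef
  have hsub : ∀ s t : C, (s - t) ^ q = s ^ q - t ^ q := fun s t => by
    rw [hqe, sub_pow_char_pow]
  have : Algebra.FiniteType k R :=
    (Subalgebra.fg_iff_finiteType R).1 (Subalgebra.fg_def.2 ⟨_, Set.toFinite _, rfl⟩)
  have : IsNoetherianRing R := Algebra.FiniteType.isNoetherianRing k R
  have : IsNoetherianRing (Localization.AtPrime I) :=
    IsLocalization.isNoetherianRing I.primeCompl _ inferInstance
  have : IsDomain (Localization.AtPrime I) :=
    IsLocalization.isDomain_localization I.primeCompl_le_nonZeroDivisors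
  let s : R := ⟨x - algebraMap k C α, sub_mem (Algebra.subset_adjoin (by simp))
    (Subalgebra.algebraMap_mem _ α)⟩
  let t : R := ⟨y - algebraMap k C β, sub_mem (Algebra.subset_adjoin (by simp))
    (Subalgebra.algebraMap_mem _ β)⟩
  let z' : R := ⟨z, Algebra.subset_adjoin (by simp)⟩
  have hsI : s ∈ I := by
    have := sub_mem (Algebra.subset_adjoin (by simp) : (x, α) ∈ gkGraph x y z α β)
      (algebraMap_mem_gkGraph α)
    rwa [Prod.mk_sub_mk, sub_self] at this
  have htI : t ∈ I := by
    have := sub_mem (Algebra.subset_adjoin (by simp) : (y, β) ∈ gkGraph x y z α β)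
      (algebraMap_mem_gkGraph β)
    rwa [Prod.mk_sub_mk, sub_self] at this
  have hzI : z' ∈ I := (Algebra.subset_adjoin (by simp) : (z, 0) ∈ gkGraph x y z α β)
  have hunit : ∀ {w : R}, w ∉ I → IsUnit (algebraMap R (Localization.AtPrime I) w) := fun hw =>
    IsLocalization.map_units (M := I.primeCompl) _ ⟨_, hw⟩
  have hone : ∀ {w : R}, w ∈ I → w + 1 ∉ I := fun {w} hw h =>
    hI.ne_top ((Ideal.eq_top_iff_one _).2 (by simpa using sub_mem h hw))
  -- Since `β ^ q ^ 2 = β`, one has `t ^ q ^ 2 - t = z ^ m`; the cofactor `t ^ (q ^ 2 - 1) - 1` is a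
  -- unit at the point.
  have htz : z' ∣ t * (t ^ (q ^ 2 - 1) - 1) := by
    refine ⟨z' ^ (m - 1), ?_⟩
    rw [← pow_succ', Nat.sub_add_cancel hm, mul_sub, ← pow_succ', Nat.sub_add_cancel (by nlinarith)]
    apply Subtype.ext
    simp only [t, z', Subalgebra.coe_sub, Subalgebra.coe_pow, mul_one, hyz]
    rw [sq q, pow_mul, hsub, hsub, ← pow_mul, ← pow_mul, ← sq, ← map_pow, hβ]
    ring
  -- Subtracting the curve equations at `(x, y)` and `(α, β)` gives `s ^ q + s = (t + β) ^ (q + 1) -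
  -- β ^ (q + 1)`, which is divisible by `t`.
  have hst : t ∣ s * (s ^ (q - 1) + 1) := by
    refine ⟨t ^ q + algebraMap k R β * t ^ (q - 1) + algebraMap k R (β ^ q), ?_⟩
    rw [mul_add, ← pow_succ', Nat.sub_add_cancel (by omega), mul_add, mul_add, mul_left_comm,
      ← pow_succ' t (q - 1), Nat.sub_add_cancel (by omega), mul_one]
    apply Subtype.ext
    have hαβ' := congrArg (algebraMap k C) hαβ
    simp only [map_add, map_pow] at hαβ'
    simp only [s, t, Subalgebra.coe_pow, Subalgebra.coe_mul,
      Subalgebra.coe_add, Subalgebra.coe_algebraMap, hsub, map_pow]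
    linear_combination hxy - hαβ'
  let ι := algebraMap R (Localization.AtPrime I)
  have htz' : ι z' ∣ ι t := by
    have h1 := map_dvd ι htz
    rw [map_mul] at h1
    refine (IsUnit.dvd_mul_right (hunit fun h => ?_)).1 h1
    have h2 : t ^ (q ^ 2 - 1) ∈ I := Ideal.pow_mem_of_mem _ htI _ (by
      have : 1 < q ^ 2 := by nlinarith
      omega)
    exact hI.ne_top ((Ideal.eq_top_iff_one _).2 (by simpa using sub_mem h2 h))
  have hsz' : ι z' ∣ ι s := by
    refine htz'.trans ?_
    have h1 := map_dvd ι hst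
    rw [map_mul] at h1
    exact (IsUnit.dvd_mul_right (hunit (hone (Ideal.pow_mem_of_mem _ hsI _ (by omega))))).1 h1
  have hmax : IsLocalRing.maximalIdeal (Localization.AtPrime I) = Ideal.span {ι z'} := by
    rw [← Localization.AtPrime.map_eq_maximalIdeal]
    refine le_antisymm (Ideal.map_le_iff_le_comap.2 fun r hr => ?_) ?_
    · obtain ⟨c, hc, hcs⟩ := mem_span_of_mem_gkIdeal (α := α) (β := β) r
      have hle : Ideal.span {w : R | (w : C) = x - algebraMap k C α ∨
          (w : C) = y - algebraMap k C β ∨ (w : C) = z} ≤ I ⊓ (Ideal.span {ι z'}).comap ι := by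
        rw [Ideal.span_le]
        rintro w (hw | hw | hw)
        · rw [show w = s from Subtype.ext hw]
          exact ⟨hsI, Ideal.mem_span_singleton.2 hsz'⟩
        · rw [show w = t from Subtype.ext hw]
          exact ⟨htI, Ideal.mem_span_singleton.2 htz'⟩
        · rw [show w = z' from Subtype.ext hw]
          exact ⟨hzI, Ideal.mem_span_singleton_self _⟩
      have hc0 : c = 0 := by
        by_contra hc0
        have h1 : algebraMap k R c ∈ I := by
          have := sub_mem hr (hle hcs).1
          rwa [sub_sub_cancel] at this
        exact hI.ne_top (Ideal.eq_top_of_isUnit_mem _ h1 ((IsUnit.mk0 c hc0).map (algebraMap k R)))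
      rw [hc0, map_zero, sub_zero] at hcs
      exact (hle hcs).2
    · rw [Ideal.span_singleton_le_iff_mem]
      exact Ideal.mem_map_of_mem _ hzI
  -- A Noetherian local domain with principal maximal ideal is a valuation ring.
  have htfae := (tfae_of_isNoetherianRing_of_isLocalRing_of_isDomain
    (Localization.AtPrime I)).out 1 4
  exact htfae.2 ⟨⟨_, hmax⟩⟩

omit hp [CharP k p] in
-- Both `Q` and `Q'` dominate the same local ring, a valuation ring with fraction field `C`. For `f
-- = r / s`, either `f` or `f⁻¹` is some `u / w` with `w` outside the ideal, and whether `u` lies in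
-- the ideal decides its value in the same way at `Q` and at `Q'`.
theorem valuationSubring_le_of_point (htop : IntermediateField.adjoin k {x, y, z} = ⊤)
    [hI : (gkIdeal x y z α β).IsPrime]
    [hV : ValuationRing (Localization.AtPrime (gkIdeal x y z α β))]
    {Q Q' : ValuationSubring C}
    (hk : ∀ c : k, algebraMap k C c ∈ Q) (hx : x - algebraMap k C α ∈ Q.nonunits)
    (hy : y - algebraMap k C β ∈ Q.nonunits) (hz : z ∈ Q.nonunits)
    (hk' : ∀ c : k, algebraMap k C c ∈ Q') (hx' : x - algebraMap k C α ∈ Q'.nonunits)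
    (hy' : y - algebraMap k C β ∈ Q'.nonunits) (hz' : z ∈ Q'.nonunits) : Q ≤ Q' := by
  have hin : ∀ {V : ValuationSubring C}, (∀ c : k, algebraMap k C c ∈ V) →
      x - algebraMap k C α ∈ V.nonunits → y - algebraMap k C β ∈ V.nonunits → z ∈ V.nonunits →
      ∀ r : Algebra.adjoin k {x, y, z}, r ∈ gkIdeal x y z α β → V.valuation r < 1 := by
    intro V h1 h2 h3 h4 r hr
    have := valuation_sub_lt_one_of_mem_gkGraph h1 h2 h3 h4 (mem_gkIdeal.1 hr)
    rwa [map_zero, sub_zero, ValuationSubring.mem_nonunits_iff] at this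
  have hout : ∀ {V : ValuationSubring C}, (∀ c : k, algebraMap k C c ∈ V) →
      x - algebraMap k C α ∈ V.nonunits → y - algebraMap k C β ∈ V.nonunits → z ∈ V.nonunits →
      ∀ r : Algebra.adjoin k {x, y, z}, r ∉ gkIdeal x y z α β → V.valuation r = 1 := by
    intro V h1 h2 h3 h4 r hr
    obtain ⟨c, hc⟩ := exists_mem_gkGraph (α := α) (β := β) r.2
    have hc0 : c ≠ 0 := by rintro rfl; exact hr hc
    have := valuation_sub_lt_one_of_mem_gkGraph h1 h2 h3 h4 hc
    rw [ValuationSubring.mem_nonunits_iff] at this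
    have hc1 := valuation_algebraMap_eq_one h1 hc0
    rw [← sub_add_cancel (r : C) (algebraMap k C c), V.valuation.map_add_eq_of_lt_right, hc1]
    rwa [hc1]
  intro f hf
  have hfm : f ∈ IntermediateField.adjoin k {x, y, z} := htop ▸ IntermediateField.mem_top
  obtain ⟨r, hr, s, hs, rfl⟩ := IntermediateField.mem_adjoin_iff_div.1 hfm
  rcases eq_or_ne r 0 with rfl | hr0
  · rw [zero_div]; exact zero_mem _
  rcases eq_or_ne s 0 with rfl | hs0
  · rw [div_zero]; exact zero_mem _
  let ι := algebraMap (Algebra.adjoin k {x, y, z}) (Localization.AtPrime (gkIdeal x y z α β))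
  have hinj : Function.Injective ι :=
    IsLocalization.injective _ (gkIdeal x y z α β).primeCompl_le_nonZeroDivisors
  obtain ⟨c, hc⟩ := ValuationRing.cond (ι ⟨r, hr⟩) (ι ⟨s, hs⟩)
  obtain ⟨⟨u, w⟩, hcu⟩ := IsLocalization.surj (gkIdeal x y z α β).primeCompl c
  have hw : (w : Algebra.adjoin k {x, y, z}) ∉ gkIdeal x y z α β := w.2
  have hQw := hout hk hx hy hz _ hw
  have hQw' := hout hk' hx' hy' hz' _ hw
  simp only at hcu
  rw [← ValuationSubring.valuation_le_one_iff, map_div₀] at hf ⊢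
  have hvr : ∀ V : ValuationSubring C, V.valuation r ≠ 0 := fun V => by simpa using hr0
  have hvs : ∀ V : ValuationSubring C, V.valuation s ≠ 0 := fun V => by simpa using hs0
  rcases hc with hc | hc
  · have h1 : r * u = s * (w : Algebra.adjoin k {x, y, z}) := by
      have : ι (⟨r, hr⟩ * u) = ι (⟨s, hs⟩ * w) := by
        rw [map_mul, map_mul, ← hc, mul_assoc, ← hcu]
      exact congrArg Subtype.val (hinj this)
    have h2 := congrArg Q.valuation h1
    have h3 := congrArg Q'.valuation h1
    rw [map_mul, map_mul, hQw, mul_one] at h2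
    rw [map_mul, map_mul, hQw', mul_one] at h3
    have hu : u ∉ gkIdeal x y z α β := by
      intro hu
      have h4 := hin hk hx hy hz _ hu
      rw [← h2, div_mul_cancel_left₀ (hvr Q)] at hf
      have h5 : Q.valuation u ≠ 0 := by
        intro h; rw [h, mul_zero] at h2; exact hvs Q h2.symm
      exact absurd ((inv_le_one₀ (zero_lt_iff.2 h5)).1 hf) (not_le.2 h4)
    rw [hout hk' hx' hy' hz' _ hu, mul_one] at h3
    rw [h3, div_self (hvs Q')]
  · have h1 : s * u = r * (w : Algebra.adjoin k {x, y, z}) := by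
      have : ι (⟨s, hs⟩ * u) = ι (⟨r, hr⟩ * w) := by
        rw [map_mul, map_mul, ← hc, mul_assoc, ← hcu]
      exact congrArg Subtype.val (hinj this)
    have h3 := congrArg Q'.valuation h1
    rw [map_mul, map_mul, hQw', mul_one] at h3
    rw [← h3, mul_div_cancel_left₀ _ (hvs Q')]
    by_cases hu : u ∈ gkIdeal x y z α β
    · exact (hin hk' hx' hy' hz' _ hu).le
    · exact (hout hk' hx' hy' hz' _ hu).le

/-- There is at most one place at which `x` and `y` take the values `α` and `β`. -/
theorem valuationSubring_eq_of_point (he : 0 < e) (hqe : q = p ^ e)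
    (hm : 0 < m) (hqm : q.Coprime m) (htop : IntermediateField.adjoin k {x, y, z} = ⊤)
    (hxy : x ^ q + x = y ^ (q + 1)) (hyz : z ^ m = y ^ q ^ 2 - y)
    {P : ValuationSubring C} (hkP : ∀ c : k, algebraMap k C c ∈ P) (hyP : y ∉ P)
    (hβ : β ^ q ^ 2 = β) (hαβ : α ^ q + α = β ^ (q + 1))
    {Q Q' : ValuationSubring C}
    (hk : ∀ c : k, algebraMap k C c ∈ Q) (hx : x - algebraMap k C α ∈ Q.nonunits)
    (hy : y - algebraMap k C β ∈ Q.nonunits)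
    (hk' : ∀ c : k, algebraMap k C c ∈ Q') (hx' : x - algebraMap k C α ∈ Q'.nonunits)
    (hy' : y - algebraMap k C β ∈ Q'.nonunits) : Q = Q' := by
  have hq : 2 ≤ q := hqe ▸ hp.out.two_le.trans (Nat.le_self_pow he.ne' p)
  have hCp : CharP C p := charP_of_injective_algebraMap (algebraMap k C).injective p
  have hsub : ∀ s t : C, (s - t) ^ q = s ^ q - t ^ q := fun s t => by
    rw [hqe, sub_pow_char_pow]
  -- `z` vanishes wherever `y - β` does, because `z ^ m = (y - β) ^ q ^ 2 - (y - β)`.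
  have hz : ∀ {V : ValuationSubring C}, y - algebraMap k C β ∈ V.nonunits → z ∈ V.nonunits := by
    intro V h
    rw [ValuationSubring.mem_nonunits_iff] at h ⊢
    have h1 : z ^ m = (y - algebraMap k C β) ^ q ^ 2 - (y - algebraMap k C β) := by
      rw [hyz, sq q, pow_mul, pow_mul, hsub, hsub, ← pow_mul, ← pow_mul, ← sq, ← map_pow, hβ]
      ring
    have h2 : V.valuation (z ^ m) < 1 := by
      rw [h1]
      refine V.valuation.map_sub_lt ?_ h
      rw [map_pow]
      exact pow_lt_one' h (by positivity)
    by_contra! h3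
    rw [map_pow] at h2
    exact absurd (one_le_pow_of_one_le' h3 m) (not_le.2 h2)
  have := isPrime_gkIdeal hq hm hqm hxy hyz hkP hyP hβ hαβ
  have := valuationRing_localization_gkIdeal he hqe hm hxy hyz hβ hαβ
  exact le_antisymm
    (valuationSubring_le_of_point htop hk hx hy (hz hy) hk' hx' hy' (hz hy'))
    (valuationSubring_le_of_point htop hk' hx' hy' (hz hy') hk hx hy (hz hy))

end local_ring

/-! ### The affine form of the automorphisms fixing the pole -/

section affine

variable {k C : Type*} [Field k] [Field C] [Algebra k C] {p e q m : ℕ} {x y z : C}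
variable [hp : Fact p.Prime] [CharP k p]

/-- An automorphism fixing the common pole of `x`, `y`, `z` acts on `x` and `y` by an affine map. -/
theorem exists_affine_of_smul_eq (he : 0 < e) (hqe : q = p ^ e) (hm : 0 < m) (hqm : q.Coprime m)
    (hmk : (m : k) = 1) (hm1 : m = 1 ∨ 2 ≤ m ∧ ¬ q ^ 2 ∣ m - 1 ∧ q ^ 3 < (q + 1) * m)
    (htop : IntermediateField.adjoin k {x, y, z} = ⊤)
    (hxy : x ^ q + x = y ^ (q + 1)) (hyz : z ^ m = y ^ q ^ 2 - y)
    {P : ValuationSubring C} (hk : ∀ c : k, algebraMap k C c ∈ P) (hy : y ∉ P)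
    {g : C ≃ₐ[k] C} (hg : g • P = P) :
    ∃ a b c : k, a ≠ 0 ∧ a ^ q ^ 2 = a ∧ b ^ q ^ 2 = b ∧ c ^ q + c = b ^ (q + 1) ∧
      g y = algebraMap k C a * y + algebraMap k C b ∧
      g x = algebraMap k C (a ^ (q + 1)) * x + algebraMap k C (a * b ^ q) * y + algebraMap k C c := by
  have hq : 2 ≤ q := hqe ▸ hp.out.two_le.trans (Nat.le_self_pow he.ne' p)
  have hqk : (q : k) = 0 := by rw [hqe, Nat.cast_pow, CharP.cast_eq_zero, zero_pow he.ne']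
  obtain ⟨T, hT, hTi⟩ := exists_valuation_gkMono hq hm hqm hxy hyz hy
  have hspan : ∀ r ∈ Algebra.adjoin k {x, y, z}, ∀ d, P.valuation r = T ^ d →
      g r ∈ Submodule.span k (gkMono x y z '' {i ∈ gkIdx q m | gkWt q m i ≤ d}) := by
    intro r hr d hd
    refine mem_span_gkMono_of_valuation_le hq hm hqm hxy hyz hk hT hTi
      (apply_mem_adjoin hq hm hqm hqk hmk htop hxy hyz hk hy hg hr) ?_
    rw [valuation_apply_eq hq hm hqm hqk hmk htop hxy hyz hk hy hg hr, hd]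
  have hvx : P.valuation x = T ^ ((q + 1) * m) := by
    simpa [gkMono, gkWt] using hTi (1, 0, 0)
  have hvy : P.valuation y = T ^ (q * m) := by
    simpa [gkMono, gkWt] using hTi (0, 1, 0)
  have hvz : P.valuation z = T ^ q ^ 3 := by
    simpa [gkMono, gkWt] using hTi (0, 0, 1)
  obtain ⟨a, u, hgy, hu, hu'⟩ := exists_of_mem_span_wt_y hq hm
    (hspan y (Algebra.subset_adjoin (by simp)) _ hvy)
  obtain ⟨a', v, w, hgx, hv, hw⟩ := exists_of_mem_span_wt_x hq hm
    (hspan x (Algebra.subset_adjoin (by simp)) _ hvx)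
  -- For `m = 1` the degree bound already makes `u` constant; otherwise the Kummer relation is
  -- needed.
  obtain ⟨b, rfl⟩ : ∃ b, u = Polynomial.C b := by
    rcases hm1 with rfl | ⟨hm2, hdvd, hm3⟩
    · exact ⟨u.coeff 0, Polynomial.eq_C_of_natDegree_eq_zero (by omega)⟩
    · obtain ⟨ζ, η, d, hgz⟩ := exists_of_mem_span_wt_z hq hm3
        (hspan z (Algebra.subset_adjoin (by simp)) _ hvz)
      -- Without its `z` term, `g z` would have pole order at most `0` or equal to `q * m`. It must
      -- be `q ^ 3`, and `q * m = q ^ 3` would give `q ∣ m`.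
      have hζ : ζ ≠ 0 := by
        rintro rfl
        have h1 := valuation_apply_eq hq hm hqm hqk hmk htop hxy hyz hk hy hg
          (r := z) (Algebra.subset_adjoin (by simp))
        have hd : P.valuation (algebraMap k C d) ≤ 1 := (P.valuation_le_one_iff _).2 (hk d)
        rw [hgz, map_zero, zero_mul, zero_add, hvz] at h1
        rcases eq_or_ne η 0 with rfl | hη
        · rw [map_zero, zero_mul, zero_add] at h1
          rw [h1] at hd
          exact absurd hd (not_le.2 (one_lt_pow' hT (by positivity)))
        · have h2 : P.valuation (algebraMap k C η * y) = T ^ (q * m) := by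
            rw [map_mul, valuation_algebraMap_eq_one hk hη, one_mul, hvy]
          rw [P.valuation.map_add_eq_of_lt_left, h2] at h1
          · have h3 : q * m = q ^ 3 := pow_right_injective₀ (zero_lt_one.trans hT) hT.ne' h1
            have h4 : q ∣ m := ⟨q, Nat.eq_of_mul_eq_mul_left (by omega : 0 < q) (by rw [h3]; ring)⟩
            have := Nat.Coprime.eq_one_of_dvd hqm h4
            omega
          · rw [h2]
            exact hd.trans_lt (one_lt_pow' hT (by positivity))
      refine exists_eq_C_of_kummer_relation he hqe hm2 hqm hmk hdvd hxy hyz hk hy hζ hu'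
        (b := η) (c := d) (a := a) ?_
      rw [← hgy, ← hgz, ← map_pow, hyz, map_sub, map_pow]
  rw [Polynomial.aeval_C] at hgy
  have hrel : (algebraMap k C a' * x + Polynomial.aeval z v + y * Polynomial.aeval z w) ^ q
      + (algebraMap k C a' * x + Polynomial.aeval z v + y * Polynomial.aeval z w)
      = (algebraMap k C a * y + algebraMap k C b) ^ (q + 1) := by
    rw [← hgx, ← hgy, ← map_pow, ← map_pow, ← map_add, hxy]
  obtain ⟨c, rfl, rfl, hc, hab, rfl, haq⟩ :=
    eq_of_hermitian_relation he hqe hm hqm hxy hyz hk hy hv hw hrel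
  have ha : a ≠ 0 := by
    rintro rfl
    rw [map_zero, zero_mul, zero_add] at hgy
    have : y = algebraMap k C b := g.injective (by rw [hgy, AlgEquiv.commutes])
    exact hy (this ▸ hk b)
  refine ⟨a, b, c, ha, ?_, ?_, hc, hgy, ?_⟩
  · have haq0 : a ^ q ≠ 0 := pow_ne_zero _ ha
    have h1 : a ^ q ^ 2 * a ^ q = a * a ^ q := by
      rw [sq, pow_mul, ← pow_succ', ← mul_pow, ← pow_succ, haq]
    exact mul_right_cancel₀ haq0 h1
  · rw [mul_pow, ← pow_mul, ← sq] at hab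
    exact mul_left_cancel₀ (pow_ne_zero _ ha) hab
  · rw [hgx, Polynomial.aeval_C, Polynomial.aeval_C]
    ring

end affine

/-! ### Counting points and fixed points on the Hermitian curve -/

section counting

open Polynomial

variable {k : Type*} [Field k] {p e q : ℕ} [hp : Fact p.Prime] [CharP k p]

omit hp [CharP k p] in
theorem card_rootSet_of_dvd_X_pow_card_sub_X [Fintype k] [DecidableEq k] {f : k[X]}
    (hf : f ∣ X ^ Fintype.card k - X) : f.roots.toFinset.card = f.natDegree := by
  have h0 : (X ^ Fintype.card k - X : k[X]) ≠ 0 :=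
    FiniteField.X_pow_card_sub_X_ne_zero k Fintype.one_lt_card
  have hroots := FiniteField.roots_X_pow_card_sub_X k
  have hspl : (X ^ Fintype.card k - X : k[X]).Splits := by
    rw [splits_iff_card_roots, hroots,
      FiniteField.X_pow_card_sub_X_natDegree_eq k Fintype.one_lt_card]
    rfl
  have hfspl : f.Splits := hspl.of_dvd h0 hf
  have hnodup : f.roots.Nodup := Multiset.nodup_of_le (roots.le_of_dvd h0 hf)
    (by rw [hroots]; exact Finset.nodup _)
  rw [Multiset.toFinset_card_of_nodup hnodup]
  exact splits_iff_card_roots.1 hfspl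

theorem X_pow_sub_X_dvd (hqe : q = p ^ e) (n : ℕ) :
    (X ^ q ^ 2 - X : k[X]) ∣ X ^ (q ^ 2) ^ n - X := by
  have hsub : ∀ s t : k[X], (s - t) ^ q ^ 2 = s ^ q ^ 2 - t ^ q ^ 2 := fun s t => by
    rw [hqe, ← pow_mul, sub_pow_char_pow]
  induction n with
  | zero => simp
  | succ n ih =>
    have : (X ^ (q ^ 2) ^ (n + 1) - X : k[X])
        = (X ^ (q ^ 2) ^ n - X) ^ q ^ 2 + (X ^ q ^ 2 - X) := by
      rw [hsub, ← pow_mul X, ← pow_succ (q ^ 2)]; ring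
    rw [this]
    rcases Nat.eq_zero_or_pos (q ^ 2) with h | h
    · have : p ^ e ≠ 0 := pow_ne_zero _ hp.out.ne_zero
      exact absurd (pow_eq_zero_iff two_ne_zero |>.1 h) (hqe ▸ this)
    · exact dvd_add (dvd_pow ih h.ne') dvd_rfl

/-- For `T = X ^ q + X - γ` with `γ ^ q = γ`, one has `T ^ q - T = X ^ q ^ 2 - X`. -/
theorem X_pow_add_X_sub_C_dvd (hqe : q = p ^ e) {γ : k} (hγ : γ ^ q = γ) :
    (X ^ q + X - C γ : k[X]) ∣ X ^ q ^ 2 - X := by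
  have hq0 : 0 < q := hqe ▸ pow_pos hp.out.pos _
  have hsub : ∀ s t : k[X], (s - t) ^ q = s ^ q - t ^ q := fun s t => by
    rw [hqe, sub_pow_char_pow]
  have hadd : ∀ s t : k[X], (s + t) ^ q = s ^ q + t ^ q := fun s t => by
    rw [hqe, add_pow_char_pow]
  have : (X ^ q ^ 2 - X : k[X]) = (X ^ q + X - C γ) ^ q - (X ^ q + X - C γ) := by
    rw [hsub, hadd, ← C_pow, hγ, ← pow_mul, ← sq]; ring
  rw [this]
  exact dvd_sub (dvd_pow_self _ hq0.ne') dvd_rfl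

variable {n : ℕ}

theorem ncard_fixed_points (he : 0 < e) (hqe : q = p ^ e) (hcard : Nat.card k = q ^ (2 * n))
    [Finite k] : {β : k | β ^ q ^ 2 = β}.ncard = q ^ 2 := by
  classical
  have := Fintype.ofFinite k
  have hq : 2 ≤ q := hqe ▸ hp.out.two_le.trans (Nat.le_self_pow he.ne' p)
  have hq2 : 1 < q ^ 2 := by nlinarith
  have h1 : (X ^ q ^ 2 - X : k[X]) ∣ X ^ Fintype.card k - X := by
    rw [← Nat.card_eq_fintype_card, hcard, pow_mul]
    exact X_pow_sub_X_dvd hqe n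
  have h2 := card_rootSet_of_dvd_X_pow_card_sub_X h1
  have h0 := FiniteField.X_pow_card_sub_X_ne_zero k hq2
  rw [FiniteField.X_pow_card_sub_X_natDegree_eq k hq2] at h2
  conv_rhs => rw [← h2]
  rw [← Set.ncard_coe_finset]
  congr 1
  ext β
  simp [h0, sub_eq_zero]

theorem ncard_trace_fiber (he : 0 < e) (hqe : q = p ^ e)
    (hcard : Nat.card k = q ^ (2 * n)) [Finite k] {γ : k} (hγ : γ ^ q = γ) :
    {α : k | α ^ q + α = γ}.ncard = q := by
  classical
  have := Fintype.ofFinite k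
  have hq : 2 ≤ q := hqe ▸ hp.out.two_le.trans (Nat.le_self_pow he.ne' p)
  have h1 : (X ^ q + X - C γ : k[X]) ∣ X ^ Fintype.card k - X := by
    rw [← Nat.card_eq_fintype_card, hcard, pow_mul]
    exact (X_pow_add_X_sub_C_dvd hqe hγ).trans (X_pow_sub_X_dvd hqe n)
  have h2 := card_rootSet_of_dvd_X_pow_card_sub_X h1
  have hlt : (X - C γ : k[X]).degree < q := by
    rw [degree_X_sub_C]; exact_mod_cast hq
  have hdeg : (X ^ q + X - C γ : k[X]).natDegree = q := by
    rw [add_sub_assoc, natDegree_eq_of_degree_eq_some]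
    rw [degree_add_eq_left_of_degree_lt (by rwa [degree_X_pow]), degree_X_pow]
  have h0 : (X ^ q + X - C γ : k[X]) ≠ 0 := by
    intro h; rw [h, natDegree_zero] at hdeg; omega
  rw [hdeg] at h2
  conv_rhs => rw [← h2]
  rw [← Set.ncard_coe_finset]
  congr 1
  ext α
  simp [h0, sub_eq_zero]

omit hp [CharP k p] in
theorem pow_succ_pow_eq {β : k} (hβ : β ^ q ^ 2 = β) : (β ^ (q + 1)) ^ q = β ^ (q + 1) := by
  rw [← pow_mul, add_mul, one_mul, pow_add, ← sq, hβ, pow_succ, mul_comm]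

theorem encard_hermitian_points (he : 0 < e) (hqe : q = p ^ e)
    (hcard : Nat.card k = q ^ (2 * n)) [Finite k] :
    {P : k × k | P.2 ^ q ^ 2 = P.2 ∧ P.1 ^ q + P.1 = P.2 ^ (q + 1)}.encard = (q : ℕ∞) ^ 3 := by
  classical
  have := Fintype.ofFinite k
  let s : Finset (k × k) := {P | P.2 ^ q ^ 2 = P.2 ∧ P.1 ^ q + P.1 = P.2 ^ (q + 1)}
  let t : Finset k := {β | β ^ q ^ 2 = β}
  have ht : t.card = q ^ 2 := by
    rw [← ncard_fixed_points he hqe hcard, ← Set.ncard_coe_finset]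
    congr 1
    ext; simp [t]
  have hs : s.card = q ^ 3 := by
    rw [Finset.card_eq_sum_card_fiberwise (f := Prod.snd) (t := t)
      (by intro P hP; simp only [s, t, Finset.coe_filter, Finset.mem_univ, true_and,
            Set.mem_ofPred_eq] at hP ⊢; exact hP.1)]
    have : ∀ β ∈ t, (s.filter fun P => P.2 = β).card = q := by
      intro β hβ
      have hβ' : β ^ q ^ 2 = β := by simpa [t] using hβ
      rw [← ncard_trace_fiber he hqe hcard (pow_succ_pow_eq hβ'),
        ← Set.ncard_image_of_injective _ (f := fun α => (α, β)) (fun a b h => congrArg Prod.fst h),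
        ← Set.ncard_coe_finset]
      congr 1
      ext ⟨α, β'⟩
      simp only [s, Finset.coe_filter, Finset.mem_filter, Finset.mem_univ, true_and,
        Set.mem_ofPred_eq, Set.mem_image, Prod.mk.injEq]
      constructor
      · rintro ⟨⟨_, h⟩, rfl⟩
        exact ⟨α, h, rfl, rfl⟩
      · rintro ⟨α', h, rfl, rfl⟩
        exact ⟨⟨hβ', h⟩, rfl⟩
    rw [Finset.sum_congr rfl this, Finset.sum_const, ht, smul_eq_mul]
    ring
  have : {P : k × k | P.2 ^ q ^ 2 = P.2 ∧ P.1 ^ q + P.1 = P.2 ^ (q + 1)} = ↑s := by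
    ext; simp [s]
  rw [this, Set.encard_coe_eq_coe_finsetCard, hs]
  push_cast
  rfl

/-- The points `(α, β)` of the Hermitian curve over `𝔽_{q²}` fixed by the affine map
`(x, y) ↦ (a ^ (q + 1) * x + a * b ^ q * y + c, a * y + b)`. -/
def affineFixed (q : ℕ) (a b c : k) : Set (k × k) :=
  {P | (P.2 ^ q ^ 2 = P.2 ∧ P.1 ^ q + P.1 = P.2 ^ (q + 1)) ∧ a * P.2 + b = P.2 ∧
    a ^ (q + 1) * P.1 + a * b ^ q * P.2 + c = P.1}

theorem encard_affineFixed_one (he : 0 < e) (hqe : q = p ^ e)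
    (hcard : Nat.card k = q ^ (2 * n)) [Finite k] :
    (affineFixed q (1 : k) 0 0).encard = (q : ℕ∞) ^ 3 := by
  have hq0 : q ≠ 0 := (hqe ▸ pow_pos hp.out.pos e : 0 < q).ne'
  rw [← encard_hermitian_points he hqe hcard (k := k)]
  congr 1
  ext P
  simp [affineFixed, hq0]

/-- As `a ≠ 1`, the second coordinate of a fixed point is forced. As `a ^ (q + 1) = 1`, the
condition on the first coordinate does not depend on it, so the whole fibre over `β` is fixed. -/
theorem encard_affineFixed_of_pow_eq_one (he : 0 < e) (hqe : q = p ^ e)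
    (hcard : Nat.card k = q ^ (2 * n)) [Finite k] {a b c : k} (ha : a ≠ 1) (haq : a ^ (q + 1) = 1)
    (hne : (affineFixed q a b c).Nonempty) : (affineFixed q a b c).encard = q := by
  obtain ⟨⟨α, β⟩, ⟨hβ, hα⟩, hb, hc⟩ := hne
  simp only at hβ hα hb hc
  have : affineFixed q a b c = (fun α' => (α', β)) '' {α' : k | α' ^ q + α' = β ^ (q + 1)} := by
    ext ⟨α', β'⟩
    simp only [affineFixed, Set.mem_ofPred_eq, Set.mem_image, Prod.mk.injEq]
    constructor
    · rintro ⟨⟨_, h1⟩, h2, _⟩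
      have : β' = β := by
        have : (a - 1) * (β' - β) = 0 := by linear_combination h2 - hb
        exact sub_eq_zero.1 ((mul_eq_zero.1 this).resolve_left (sub_ne_zero.2 ha))
      subst this
      exact ⟨α', h1, rfl, rfl⟩
    · rintro ⟨α'', h, rfl, rfl⟩
      exact ⟨⟨hβ, h⟩, hb, by linear_combination hc + (α'' - α) * haq⟩
  rw [this, Function.Injective.encard_image (fun a b h => congrArg Prod.fst h),
    ← Set.Finite.cast_ncard_eq (Set.toFinite _),
    ncard_trace_fiber he hqe hcard (pow_succ_pow_eq hβ)]

omit hp [CharP k p] in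
theorem encard_affineFixed_of_pow_ne_one {a b c : k} (ha : a ≠ 1) (haq : a ^ (q + 1) ≠ 1)
    (hne : (affineFixed q a b c).Nonempty) : (affineFixed q a b c).encard = 1 := by
  obtain ⟨⟨α, β⟩, h⟩ := hne
  rw [Set.encard_eq_one]
  refine ⟨(α, β), Set.eq_singleton_iff_unique_mem.2 ⟨h, ?_⟩⟩
  obtain ⟨⟨hβ, hα⟩, hb, hc⟩ := h
  rintro ⟨α', β'⟩ ⟨_, h2, h3⟩
  simp only at hb hc h2 h3
  have hβ' : β' = β := by
    have : (a - 1) * (β' - β) = 0 := by linear_combination h2 - hb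
    exact sub_eq_zero.1 ((mul_eq_zero.1 this).resolve_left (sub_ne_zero.2 ha))
  subst hβ'
  have hα' : α' = α := by
    have : (a ^ (q + 1) - 1) * (α' - α) = 0 := by linear_combination h3 - hc
    exact sub_eq_zero.1 ((mul_eq_zero.1 this).resolve_left (sub_ne_zero.2 haq))
  rw [hα']

end counting

/-! ### Fixed points and the order of the affine map -/

section order

variable {k C : Type*} [Field k] [Field C] [Algebra k C] {p e q : ℕ} {x y : C} {a b c : k}

theorem pow_apply_eq_of_scaling {g : C ≃ₐ[k] C} {t : C} {A : k}
    (h : g t = algebraMap k C A * t) (N : ℕ) : (g ^ N) t = algebraMap k C (A ^ N) * t := by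
  induction N with
  | zero => simp
  | succ N ih =>
    rw [pow_succ', AlgEquiv.mul_apply, ih, map_mul, AlgEquiv.commutes, h, pow_succ, map_mul]
    ring

theorem pow_apply_eq_of_translation {g : C ≃ₐ[k] C} {t : C} {d : k}
    (h : g t = t + algebraMap k C d) (N : ℕ) : (g ^ N) t = t + algebraMap k C (N * d) := by
  induction N with
  | zero => simp
  | succ N ih =>
    rw [pow_succ', AlgEquiv.mul_apply, ih, map_add, AlgEquiv.commutes, h, Nat.cast_succ, add_mul,
      one_mul, map_add (algebraMap k C)]
    ring

variable [hp : Fact p.Prime] [CharP k p]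

/-- If the affine map fixes a point of the curve, it is diagonal in the coordinates `y - β` and
`x - α - β ^ q * (y - β)`. -/
theorem pow_fixes_iff_of_mem_affineFixed (hqe : q = p ^ e)
    (hy : ∀ d : k, y ≠ algebraMap k C d) {g : C ≃ₐ[k] C}
    (hgy : g y = algebraMap k C a * y + algebraMap k C b)
    (hgx : g x = algebraMap k C (a ^ (q + 1)) * x + algebraMap k C (a * b ^ q) * y
      + algebraMap k C c)
    (hne : (affineFixed q a b c).Nonempty) (N : ℕ) :
    ((g ^ N) x = x ∧ (g ^ N) y = y) ↔ a ^ N = 1 := by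
  obtain ⟨⟨α, β⟩, _, hb, hc⟩ := hne
  simp only at hb hc
  have hbq : a ^ q * β ^ q + b ^ q = β ^ q := by
    rw [← mul_pow]
    conv_rhs => rw [← hb]
    rw [hqe, add_pow_char_pow]
  have hb' := congrArg (algebraMap k C) hb
  have hc' := congrArg (algebraMap k C) hc
  have hbq' := congrArg (algebraMap k C) hbq
  simp only [map_add, map_mul, map_pow] at hb' hc' hbq'
  have ht : g (y - algebraMap k C β) = algebraMap k C a * (y - algebraMap k C β) := by
    rw [map_sub, AlgEquiv.commutes, hgy]
    linear_combination hb'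
  have hs : g (x - algebraMap k C α - algebraMap k C (β ^ q) * (y - algebraMap k C β))
      = algebraMap k C (a ^ (q + 1)) *
        (x - algebraMap k C α - algebraMap k C (β ^ q) * (y - algebraMap k C β)) := by
    rw [map_sub, map_mul, AlgEquiv.commutes, ht, map_sub, AlgEquiv.commutes, hgx]
    simp only [map_mul, map_pow]
    linear_combination hc' + (algebraMap k C a * (y - algebraMap k C β)) * hbq'
  have ht' := pow_apply_eq_of_scaling ht N
  have hs' := pow_apply_eq_of_scaling hs N
  have ht0 : y - algebraMap k C β ≠ 0 := sub_ne_zero.2 (hy β)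
  constructor
  · rintro ⟨_, h2⟩
    rw [map_sub, AlgEquiv.commutes, h2] at ht'
    have : algebraMap k C (a ^ N) = 1 := by
      apply mul_right_cancel₀ ht0
      rw [← ht', one_mul]
    exact (algebraMap k C).injective (by rw [this, map_one])
  · intro h
    rw [h, map_one, one_mul] at ht'
    rw [← pow_mul, mul_comm (q + 1), pow_mul, h, one_pow, map_one, one_mul, map_sub, map_mul,
      AlgEquiv.commutes, ht', map_sub, AlgEquiv.commutes] at hs'
    refine ⟨sub_left_injective (sub_left_injective hs'), ?_⟩
    rw [map_sub, AlgEquiv.commutes] at ht'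
    exact sub_left_injective ht'

/-- A translation `t ↦ t + d` with trivial `N`-th power has `N * d = 0`, so `d = 0` when `p ∤ N`.
This removes the only obstruction to solving for a fixed point, which arises when an eigenvalue `a`
or `a ^ (q + 1)` is `1`. -/
theorem affineFixed_nonempty_of_pow_fixes {n : ℕ} (he : 0 < e) (hqe : q = p ^ e)
    (hcard : Nat.card k = q ^ (2 * n)) [Finite k]
    (ha : a ^ q ^ 2 = a) (hb : b ^ q ^ 2 = b) (ha0 : a ≠ 0) (hc : c ^ q + c = b ^ (q + 1))
    {g : C ≃ₐ[k] C}
    (hgy : g y = algebraMap k C a * y + algebraMap k C b)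
    (hgx : g x = algebraMap k C (a ^ (q + 1)) * x + algebraMap k C (a * b ^ q) * y
      + algebraMap k C c) {N : ℕ} (hN : ¬ p ∣ N) (hx' : (g ^ N) x = x) (hy' : (g ^ N) y = y) :
    (affineFixed q a b c).Nonempty := by
  have hq : 2 ≤ q := hqe ▸ hp.out.two_le.trans (Nat.le_self_pow he.ne' p)
  have hNk : (N : k) ≠ 0 := fun h => hN ((CharP.cast_eq_zero_iff k p N).1 h)
  have hadd : ∀ s t : k, (s + t) ^ q = s ^ q + t ^ q := fun s t => by
    rw [hqe, add_pow_char_pow]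
  have htrans : ∀ {t : C} {d : k}, g t = t + algebraMap k C d → (g ^ N) t = t → d = 0 := by
    intro t d h h'
    rw [pow_apply_eq_of_translation h N] at h'
    have h'' : algebraMap k C (N * d) = 0 := by linear_combination h'
    exact (mul_eq_zero.1 ((map_eq_zero _).1 h'')).resolve_left hNk
  by_cases ha1 : a = 1
  · subst ha1
    have hb0 : b = 0 := htrans (by rw [hgy, map_one, one_mul]) hy'
    subst hb0
    have hc0 : c = 0 := htrans (by
      rw [hgx, zero_pow (by omega), mul_zero, map_zero, zero_mul, one_pow, map_one, one_mul,
        add_zero]) hx'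
    subst hc0
    refine ⟨(0, 0), ?_⟩
    have : q ≠ 0 := by omega
    simp [affineFixed, this]
  · have h1a : 1 - a ≠ 0 := sub_ne_zero.2 (Ne.symm ha1)
    obtain ⟨β, hβ⟩ : ∃ β, a * β + b = β := ⟨b / (1 - a), by field_simp; ring⟩
    have hβq : a ^ q * β ^ q + b ^ q = β ^ q := by
      rw [← mul_pow]
      conv_rhs => rw [← hβ]
      rw [hadd]
    have hβqq : β ^ q ^ 2 = β := by
      have h2 : a * β ^ q ^ 2 + b = β ^ q ^ 2 := by
        have := congrArg (· ^ q) hβq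
        simp only [hadd, mul_pow, ← pow_mul, ← sq] at this
        rwa [ha, hb] at this
      have : (1 - a) * (β ^ q ^ 2 - β) = 0 := by linear_combination hβ - h2
      exact sub_eq_zero.1 ((mul_eq_zero.1 this).resolve_left h1a)
    by_cases hA : a ^ (q + 1) = 1
    · have hd : c - β ^ q * b = 0 := by
        have hβq' := congrArg (algebraMap k C) hβq
        have hA' := congrArg (algebraMap k C) hA
        simp only [map_add, map_mul, map_pow, map_one] at hβq' hA'
        refine htrans (t := x - algebraMap k C (β ^ q) * y) ?_ ?_
        · rw [map_sub, map_mul, AlgEquiv.commutes, hgx, hgy]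
          simp only [map_sub, map_mul, map_pow]
          linear_combination algebraMap k C a * y * hβq' +
            (x - algebraMap k C β ^ q * y) * hA'
        · rw [map_sub, map_mul, AlgEquiv.commutes, hx', hy']
      have hncard := ncard_trace_fiber he hqe hcard (pow_succ_pow_eq hβqq)
      obtain ⟨α, hα⟩ := Set.nonempty_of_ncard_ne_zero (hncard ▸ (by omega : q ≠ 0))
      refine ⟨(α, β), ⟨hβqq, hα⟩, hβ, ?_⟩
      simp only
      linear_combination (α - β ^ (q + 1)) * hA + hd + a * β * hβq + β ^ q * hβ
    · have h1A : 1 - a ^ (q + 1) ≠ 0 := sub_ne_zero.2 (Ne.symm hA)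
      obtain ⟨α, hα⟩ : ∃ α, a ^ (q + 1) * α + a * b ^ q * β + c = α :=
        ⟨(a * b ^ q * β + c) / (1 - a ^ (q + 1)), by field_simp; ring⟩
      refine ⟨(α, β), ⟨hβqq, ?_⟩, hβ, hα⟩
      simp only
      have hAq := pow_succ_pow_eq ha
      have hαq : a ^ (q + 1) * α ^ q + a ^ q * b * β ^ q + c ^ q = α ^ q := by
        have := congrArg (· ^ q) hα
        simp only [hadd, mul_pow, hAq] at this
        rw [← pow_mul b, ← sq, hb] at this
        exact this
      -- The affine map multiplies the curve equation by `a ^ (q + 1) ≠ 1`, so the equation vanishes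
      -- at a fixed point.
      have : (1 - a ^ (q + 1)) * (α ^ q + α - β ^ (q + 1)) = 0 := by
        have hββ : β ^ (q + 1) = (a ^ q * β ^ q + b ^ q) * (a * β + b) := by
          rw [hβ, hβq, pow_succ]
        linear_combination -hα - hαq + hc - hββ
      exact sub_eq_zero.1 ((mul_eq_zero.1 this).resolve_left h1A)

theorem not_dvd_orderOf_of_pow_eq (he : 0 < e) (hqe : q = p ^ e) {M : Type*} [Monoid M] {a : M}
    (ha : a ^ (q ^ 2 - 1) = 1) : ¬ p ∣ orderOf a := by
  intro h
  have h1 : p ∣ q ^ 2 - 1 := h.trans (orderOf_dvd_of_pow_eq_one ha)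
  have h2 : p ∣ q ^ 2 := hqe ▸ dvd_pow (dvd_pow_self p he.ne') two_ne_zero
  have h3 : 1 ≤ q ^ 2 := Nat.one_le_pow _ _ (hqe ▸ pow_pos hp.out.pos e)
  have h4 := Nat.dvd_sub h2 h1
  rw [Nat.sub_sub_self h3] at h4
  exact hp.out.one_lt.ne' (Nat.dvd_one.1 h4)

end order

/-! ### Fixed places correspond to fixed points -/

section fixed_places

variable {k C : Type*} [Field k] [Field C] [Algebra k C] {p e q m n : ℕ} {x y z : C} {a b c : k}

theorem mem_nonunits_comap {F : IntermediateField k C} {Q : ValuationSubring C} {f : F} :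
    f ∈ (Q.comap (algebraMap F C)).nonunits ↔ (f : C) ∈ Q.nonunits := by
  rw [ValuationSubring.mem_nonunits_iff_or, ValuationSubring.mem_nonunits_iff_or,
    ValuationSubring.mem_comap, map_inv₀]
  simp

/-- The two properness conditions are automatic, because `y - β` is a nonzero nonunit. -/
theorem isQab_iff (hy : ∀ d : k, y ≠ algebraMap k C d) {α β : k} {Q : ValuationSubring C} :
    IsQab x y α β Q ↔ (∀ d : k, algebraMap k C d ∈ Q) ∧ x - algebraMap k C α ∈ Q.nonunits ∧
      y - algebraMap k C β ∈ Q.nonunits := by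
  have hiff : ∀ (f : HermK k x y) (d : k), HasValueAt (Q.comap (algebraMap (HermK k x y) C)) f d ↔
      (f : C) - algebraMap k C d ∈ Q.nonunits := fun f d => by
    rw [HasValueAt, mem_nonunits_comap]
    rfl
  constructor
  · rintro ⟨⟨h1, _⟩, _, h3, h4⟩
    exact ⟨h1, (hiff _ _).1 h3, (hiff _ _).1 h4⟩
  · rintro ⟨h1, h3, h4⟩
    have h0 : y - algebraMap k C β ≠ 0 := sub_ne_zero.2 (hy β)
    have hinv : (y - algebraMap k C β)⁻¹ ∉ Q :=
      ((ValuationSubring.mem_nonunits_iff_or _).1 h4).resolve_left h0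
    refine ⟨⟨h1, fun h => hinv (h ▸ ValuationSubring.mem_top _)⟩, ⟨fun d => ?_, fun h => ?_⟩,
      (hiff _ _).2 h3, (hiff _ _).2 h4⟩
    · exact h1 d
    · let t : HermK k x y := ⟨y, IntermediateField.subset_adjoin _ _ (by simp)⟩ - algebraMap k _ β
      have : t⁻¹ ∈ Q.comap (algebraMap (HermK k x y) C) := h ▸ ValuationSubring.mem_top _
      rw [ValuationSubring.mem_comap, map_inv₀] at this
      exact hinv this

theorem eq_of_sub_mem_nonunits {Q : ValuationSubring C} (hk : ∀ d : k, algebraMap k C d ∈ Q)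
    {f : C} {d d' : k} (h : f - algebraMap k C d ∈ Q.nonunits)
    (h' : f - algebraMap k C d' ∈ Q.nonunits) : d = d' := by
  by_contra hne
  have h1 := sub_mem h' h
  rw [sub_sub_sub_cancel_left, ← map_sub, ValuationSubring.mem_nonunits_iff,
    valuation_algebraMap_eq_one hk (sub_ne_zero.2 hne)] at h1
  exact lt_irrefl _ h1

theorem mem_nonunits_smul_iff {Q : ValuationSubring C} {g : C ≃ₐ[k] C} {f : C} :
    g f ∈ (g • Q).nonunits ↔ f ∈ Q.nonunits := by
  rw [ValuationSubring.mem_nonunits_iff_or, ValuationSubring.mem_nonunits_iff_or, ← map_inv₀,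
    EmbeddingLike.map_eq_zero_iff]
  have : g f⁻¹ ∈ g • Q ↔ f⁻¹ ∈ Q := ValuationSubring.smul_mem_pointwise_smul_iff
  rw [this]

theorem algebraMap_mul_mem_nonunits {Q : ValuationSubring C} (hk : ∀ d : k, algebraMap k C d ∈ Q)
    {f : C} (d : k) (hf : f ∈ Q.nonunits) : algebraMap k C d * f ∈ Q.nonunits := by
  rw [ValuationSubring.mem_nonunits_iff] at hf ⊢
  rw [map_mul]
  exact (mul_le_of_le_one_left' ((Q.valuation_le_one_iff _).2 (hk d))).trans_lt hf

variable [hp : Fact p.Prime] [CharP k p]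

omit hp [CharP k p] in
theorem mem_Fq2_iff (hp : p.Prime) [CharP k p] (hqe : q = p ^ e) {d : k} :
    d ∈ Fq2 k q ↔ d ^ q ^ 2 = d := by
  have := Fact.mk hp
  subst hqe
  exact mem_Fq2 d

/-- The number of fixed places `Q_{αβ}` is the number of fixed points of the affine map. -/
theorem numFixed_eq_encard_affineFixed (he : 0 < e) (hqe : q = p ^ e) (hm : 0 < m)
    (hqm : q.Coprime m) (htop : IntermediateField.adjoin k {x, y, z} = ⊤)
    (hxy : x ^ q + x = y ^ (q + 1)) (hyz : z ^ m = y ^ q ^ 2 - y)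
    {P : ValuationSubring C} (hk : ∀ c : k, algebraMap k C c ∈ P) (hy : y ∉ P)
    (ha : a ≠ 0) {g : C ≃ₐ[k] C}
    (hgy : g y = algebraMap k C a * y + algebraMap k C b)
    (hgx : g x = algebraMap k C (a ^ (q + 1)) * x + algebraMap k C (a * b ^ q) * y
      + algebraMap k C c) :
    numFixed q x y g = (affineFixed q a b c).encard := by
  have hq : 2 ≤ q := hqe ▸ hp.out.two_le.trans (Nat.le_self_pow he.ne' p)
  have hy' : ∀ d : k, y ≠ algebraMap k C d := fun d h => hy (h ▸ hk d)
  let S : Set (k × k) := {P | P.2 ^ q ^ 2 = P.2 ∧ P.1 ^ q + P.1 = P.2 ^ (q + 1)}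
  -- The membership `R ∈ S` is placed inside the existential so that the chosen `pl` is total; its
  -- value off the curve is irrelevant.
  have hex : ∀ R : k × k, ∃ Q : ValuationSubring C, R ∈ S → (∀ c : k, algebraMap k C c ∈ Q) ∧
      x - algebraMap k C R.1 ∈ Q.nonunits ∧ y - algebraMap k C R.2 ∈ Q.nonunits := by
    intro R
    by_cases hR : R ∈ S
    · obtain ⟨Q, hQ⟩ :=
        exists_valuationSubring_of_point hq hm hqm hxy hyz hk hy hR.1 hR.2
      exact ⟨Q, fun _ => hQ⟩
    · exact ⟨P, fun h => absurd h hR⟩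
  choose pl hpl using hex
  have huniq : ∀ R ∈ S, ∀ Q : ValuationSubring C, (∀ c : k, algebraMap k C c ∈ Q) →
      x - algebraMap k C R.1 ∈ Q.nonunits → y - algebraMap k C R.2 ∈ Q.nonunits → Q = pl R := by
    intro R hR Q h1 h2 h3
    obtain ⟨h4, h5, h6⟩ := hpl R hR
    exact valuationSubring_eq_of_point he hqe hm hqm htop hxy hyz hk hy hR.1 hR.2 h1 h2 h3 h4 h5 h6
  -- If `g` fixes the place, the values of `g x`, `g y` there equal those of `x`, `y`. Conversely,
  -- at a fixed point `x` and `y` keep their values at `g • pl R`, and uniqueness of the place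
  -- applies.
  have hfix : ∀ R ∈ S, (g • pl R = pl R ↔ R ∈ affineFixed q a b c) := by
    intro R hR
    obtain ⟨h1, h2, h3⟩ := hpl R hR
    have hkg : ∀ c : k, algebraMap k C c ∈ g • pl R := fun c => by
      have : g (algebraMap k C c) ∈ g • pl R :=
        ValuationSubring.smul_mem_pointwise_smul_iff.2 (h1 c)
      rwa [AlgEquiv.commutes] at this
    constructor
    · intro h
      have h2' := (mem_nonunits_smul_iff (g := g)).2 h2
      have h3' := (mem_nonunits_smul_iff (g := g)).2 h3
      rw [h, map_sub, AlgEquiv.commutes] at h2' h3'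
      refine ⟨hR, eq_of_sub_mem_nonunits h1 ?_ h3', eq_of_sub_mem_nonunits h1 ?_ h2'⟩
      · rw [hgy]
        convert algebraMap_mul_mem_nonunits h1 a h3 using 1
        simp only [map_add, map_mul]
        ring
      · rw [hgx]
        convert add_mem (algebraMap_mul_mem_nonunits h1 (a ^ (q + 1)) h2)
          (algebraMap_mul_mem_nonunits h1 (a * b ^ q) h3) using 1
        simp only [map_add, map_mul]
        ring
    · rintro ⟨_, hb, hc⟩
      have hb' := congrArg (algebraMap k C) hb
      have hc' := congrArg (algebraMap k C) hc
      simp only [map_add, map_mul] at hb' hc'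
      have ha' : algebraMap k C a ≠ 0 := by simpa using ha
      have hyg : y - algebraMap k C R.2 ∈ (g • pl R).nonunits := by
        have h4 := (mem_nonunits_smul_iff (g := g)).2 h3
        have : y - algebraMap k C R.2 = algebraMap k C a⁻¹ * g (y - algebraMap k C R.2) := by
          rw [map_sub, AlgEquiv.commutes, hgy, map_inv₀, eq_inv_mul_iff_mul_eq₀ ha']
          linear_combination -hb'
        rw [this]
        exact algebraMap_mul_mem_nonunits hkg _ h4
      refine huniq R hR _ hkg ?_ hyg
      have h4 := (mem_nonunits_smul_iff (g := g)).2 h2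
      have hA' : algebraMap k C (a ^ (q + 1)) ≠ 0 := by simpa using ha
      have : x - algebraMap k C R.1 = algebraMap k C (a ^ (q + 1))⁻¹ *
          (g (x - algebraMap k C R.1) - algebraMap k C (a * b ^ q) * (y - algebraMap k C R.2)) := by
        rw [map_sub g, AlgEquiv.commutes, hgx, map_inv₀, eq_inv_mul_iff_mul_eq₀ hA']
        simp only [map_mul]
        linear_combination -hc'
      rw [this]
      exact algebraMap_mul_mem_nonunits hkg _
        (sub_mem h4 (algebraMap_mul_mem_nonunits hkg _ hyg))
  have himage : {Q | Q ∈ placesQ k q x y ∧ g • Q = Q} = pl '' affineFixed q a b c := by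
    ext Q
    constructor
    · rintro ⟨⟨α, _, β, hβ, hαβ, hQ⟩, hgQ⟩
      rw [isQab_iff hy'] at hQ
      have hR : (α, β) ∈ S := ⟨(mem_Fq2_iff hp.out hqe).1 hβ, hαβ⟩
      have hQR := huniq _ hR Q hQ.1 hQ.2.1 hQ.2.2
      refine ⟨(α, β), (hfix _ hR).1 (hQR ▸ hgQ), hQR.symm⟩
    · rintro ⟨⟨α, β⟩, hR, rfl⟩
      have hadd : ∀ s t : k, (s + t) ^ q = s ^ q + t ^ q := fun s t => by
        rw [hqe, add_pow_char_pow]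
      obtain ⟨hβ, hα⟩ := hR.1
      simp only at hβ hα
      -- `α ^ q + α` is invariant under `q`-th powers, which forces `α` into `𝔽_{q²}`.
      have hαq : α ^ q ^ 2 = α := by
        have h1 := pow_succ_pow_eq hβ
        rw [← hα, hadd, ← pow_mul, ← sq] at h1
        linear_combination h1
      exact ⟨⟨α, (mem_Fq2_iff hp.out hqe).2 hαq, β, (mem_Fq2_iff hp.out hqe).2 hβ, hα,
        (isQab_iff hy').2 (hpl _ hR.1)⟩, (hfix _ hR.1).2 hR⟩
  rw [numFixed, himage, Set.InjOn.encard_image]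
  intro R hR R' hR' h
  obtain ⟨h1, h2, h3⟩ := hpl R hR.1
  obtain ⟨h4, h5, h6⟩ := hpl R' hR'.1
  rw [← h] at h5 h6
  exact Prod.ext (eq_of_sub_mem_nonunits h1 h2 h5) (eq_of_sub_mem_nonunits h1 h3 h6)

end fixed_places

/-! ### Restriction to the Hermitian function field -/

section restriction

variable {k C : Type*} [Field k] [Field C] [Algebra k C] {p e q : ℕ} {x y : C} {a b c : k}

theorem IsRestriction.pow {g : C ≃ₐ[k] C} {h : Herm k q x y ≃ₐ[Fq2 k q] Herm k q x y}
    (hgh : IsRestriction g h) (N : ℕ) : IsRestriction (g ^ N) (h ^ N) := by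
  induction N with
  | zero => intro f; simp
  | succ N ih =>
    intro f
    rw [pow_succ', pow_succ', AlgEquiv.mul_apply, AlgEquiv.mul_apply, hgh, ih]

theorem IsRestriction.eq_one_iff {g : C ≃ₐ[k] C} {h : Herm k q x y ≃ₐ[Fq2 k q] Herm k q x y}
    (hgh : IsRestriction g h) : h = 1 ↔ g x = x ∧ g y = y := by
  constructor
  · rintro rfl
    exact ⟨(hgh ⟨x, IntermediateField.subset_adjoin _ _ (by simp)⟩).symm,
      (hgh ⟨y, IntermediateField.subset_adjoin _ _ (by simp)⟩).symm⟩
  · rintro ⟨hx, hy⟩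
    ext ⟨f, hf⟩
    rw [hgh]
    change g f = f
    induction hf using IntermediateField.adjoin_induction with
    | mem w hw => rcases hw with rfl | rfl <;> assumption
    | algebraMap d => exact g.commutes (d : k)
    | add _ _ _ _ h1 h2 => rw [map_add, h1, h2]
    | inv _ _ h1 => rw [map_inv₀, h1]
    | mul _ _ _ _ h1 h2 => rw [map_mul, h1, h2]

theorem IsRestriction.pow_eq_one_iff {g : C ≃ₐ[k] C} {h : Herm k q x y ≃ₐ[Fq2 k q] Herm k q x y}
    (hgh : IsRestriction g h) (N : ℕ) : h ^ N = 1 ↔ (g ^ N) x = x ∧ (g ^ N) y = y :=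
  (hgh.pow N).eq_one_iff

/-- The coefficients lie in `𝔽_{q²}` and the affine map is invertible over it, so `g x, g y`
generate the same field as `x, y`. -/
theorem exists_isRestriction {g : C ≃ₐ[k] C} (ha0 : a ≠ 0) (ha : a ∈ Fq2 k q) (hb : b ∈ Fq2 k q)
    (hc : c ∈ Fq2 k q) (hgy : g y = algebraMap k C a * y + algebraMap k C b)
    (hgx : g x = algebraMap k C (a ^ (q + 1)) * x + algebraMap k C (a * b ^ q) * y
      + algebraMap k C c) :
    ∃ h : Herm k q x y ≃ₐ[Fq2 k q] Herm k q x y, IsRestriction g h := by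
  let g' : C ≃ₐ[Fq2 k q] C := g.restrictScalars (Fq2 k q)
  have hconst : ∀ (S : Set C) {d : k}, d ∈ Fq2 k q →
      algebraMap k C d ∈ IntermediateField.adjoin (Fq2 k q) S := fun S d hd =>
    (IntermediateField.adjoin (Fq2 k q) S).algebraMap_mem ⟨d, hd⟩
  have hmap : (Herm k q x y).map (g' : C →ₐ[Fq2 k q] C) = Herm k q x y := by
    rw [IntermediateField.adjoin_map]
    have himage : (g' : C →ₐ[Fq2 k q] C) '' {x, y} = {g x, g y} := by
      rw [Set.image_pair]; rfl
    rw [himage]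
    apply le_antisymm
    · rw [IntermediateField.adjoin_le_iff]
      have hx : x ∈ Herm k q x y := IntermediateField.subset_adjoin _ _ (by simp)
      have hy : y ∈ Herm k q x y := IntermediateField.subset_adjoin _ _ (by simp)
      rintro w (rfl | rfl)
      · rw [hgx]
        exact add_mem (add_mem (mul_mem (hconst _ (pow_mem ha _)) hx)
          (mul_mem (hconst _ (mul_mem ha (pow_mem hb _))) hy)) (hconst _ hc)
      · rw [hgy]
        exact add_mem (mul_mem (hconst _ ha) hy) (hconst _ hb)
    · rw [IntermediateField.adjoin_le_iff]
      have hx : g x ∈ IntermediateField.adjoin (Fq2 k q) {g x, g y} :=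
        IntermediateField.subset_adjoin _ _ (by simp)
      have hy : g y ∈ IntermediateField.adjoin (Fq2 k q) {g x, g y} :=
        IntermediateField.subset_adjoin _ _ (by simp)
      have hy' : y ∈ IntermediateField.adjoin (Fq2 k q) {g x, g y} := by
        have ha' : algebraMap k C a ≠ 0 := by simpa using ha0
        have : y = algebraMap k C a⁻¹ * (g y - algebraMap k C b) := by
          rw [hgy, map_inv₀, eq_inv_mul_iff_mul_eq₀ ha']; ring
        convert mul_mem (hconst _ (inv_mem ha)) (sub_mem hy (hconst _ hb)) using 1
      rintro w (hw | hw)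
      · have hA : algebraMap k C (a ^ (q + 1)) ≠ 0 := by simpa using ha0
        have : x = algebraMap k C (a ^ (q + 1))⁻¹ *
            (g x - algebraMap k C (a * b ^ q) * y - algebraMap k C c) := by
          rw [hgx, map_inv₀, eq_inv_mul_iff_mul_eq₀ hA]; ring
        rw [hw]
        have hmem := mul_mem (hconst _ (inv_mem (pow_mem ha (q + 1)))) (sub_mem (sub_mem hx
          (mul_mem (hconst _ (mul_mem ha (pow_mem hb q))) hy')) (hconst _ hc))
        rwa [← this] at hmem
      · exact hw ▸ hy'
  exact ⟨(IntermediateField.intermediateFieldMap g' (Herm k q x y)).trans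
    (IntermediateField.equivOfEq hmap), fun f => rfl⟩

/-- The pole of `x` in the Hermitian function field is fixed by every affine automorphism. -/
theorem smul_eq_of_isPoleOf_hermX (hq : 2 ≤ q) (hxy : x ^ q + x = y ^ (q + 1))
    {P : ValuationSubring (Herm k q x y)} (hP : IsPoleOf (Fq2 k q) P (hermX k q x y))
    {g : C ≃ₐ[k] C} {h : Herm k q x y ≃ₐ[Fq2 k q] Herm k q x y} (hgh : IsRestriction g h)
    (ha : a ∈ Fq2 k q) (hb : b ∈ Fq2 k q)
    (hgy : g y = algebraMap k C a * y + algebraMap k C b) : h • P = P := by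
  let Y : Herm k q x y := ⟨y, IntermediateField.subset_adjoin _ _ (by simp)⟩
  have hxyH : hermX k q x y ^ q + hermX k q x y = Y ^ (q + 1) := Subtype.ext hxy
  have hYP : Y ∉ P := fun hY => hP.2
    (ValuationSubring.mem_of_pow_add_mem hq (hxyH ▸ pow_mem hY _))
  have hkh : ∀ d : Fq2 k q, algebraMap (Fq2 k q) (Herm k q x y) d ∈ h • P := fun d => by
    have : h (algebraMap _ _ d) ∈ h • P :=
      ValuationSubring.smul_mem_pointwise_smul_iff.2 (hP.1.1 d)
    rwa [AlgEquiv.commutes] at this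
  have hYh : Y ∉ h • P := by
    intro hY
    have h1 : h Y = algebraMap (Fq2 k q) _ ⟨a, ha⟩ * Y + algebraMap (Fq2 k q) _ ⟨b, hb⟩ := by
      apply Subtype.ext
      rw [hgh Y]
      exact hgy
    have h2 : h Y ∈ h • P := h1 ▸ add_mem (mul_mem (hkh _) hY) (hkh _)
    exact hYP (ValuationSubring.smul_mem_pointwise_smul_iff.1 h2)
  -- The Hermitian field satisfies the defining relations with `m = 1` and `z = y ^ q ^ 2 - y`, so
  -- `pole_unique` applies to it over `𝔽_{q²}`.
  have htop : IntermediateField.adjoin (Fq2 k q) {hermX k q x y, Y, Y ^ q ^ 2 - Y} = ⊤ := by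
    rw [eq_top_iff]
    have : IntermediateField.adjoin (Fq2 k q) {hermX k q x y, Y} = ⊤ := by
      apply IntermediateField.lift_injective
      rw [IntermediateField.lift_adjoin, IntermediateField.lift_top, Set.image_pair]
      rfl
    rw [← this]
    exact IntermediateField.adjoin.mono _ _ _ (by
      rintro w (rfl | rfl) <;> simp)
  exact pole_unique hq one_pos (Nat.coprime_one_right q) htop hxyH (pow_one _) hkh hYh hP.1.1 hYP

end restriction

/-! ### The count of fixed places -/

theorem theorem4p2 (p e q n : ℕ) (hp : p.Prime) (he : 0 < e) (hq : q = p ^ e) (hn : Odd n)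
    {k C : Type*} [Field k] [Field C] [Algebra k C] (hk : Nat.card k = q ^ (2 * n))
    (x y z : C) (hC : IsGGK k q n x y z)
    (Qinf : ValuationSubring C) (hQ : IsPoleOf k Qinf z)
    (Pinf : ValuationSubring (Herm k q x y)) (hP : IsPoleOf (Fq2 k q) Pinf (hermX k q x y))
    (g : C ≃ₐ[k] C) (hg : g ∈ MulAction.stabilizer (C ≃ₐ[k] C) Qinf) :
    ∃ h ∈ MulAction.stabilizer (Herm k q x y ≃ₐ[Fq2 k q] Herm k q x y) Pinf,
      IsRestriction g h ∧
      ((p ∣ orderOf h → numFixed q x y g = 0) ∧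
       (h = 1 → numFixed q x y g = (q : ℕ∞) ^ 3) ∧
       (¬ p ∣ orderOf h → h ≠ 1 → orderOf h ∣ q + 1 → numFixed q x y g = (q : ℕ∞)) ∧
       (¬ p ∣ orderOf h → h ≠ 1 → ¬ orderOf h ∣ q + 1 → numFixed q x y g = 1)) := by
  obtain ⟨htop, -, hxy, hyz⟩ := hC
  have : Fact p.Prime := ⟨hp⟩
  have hq2 : 2 ≤ q := hq ▸ hp.two_le.trans (Nat.le_self_pow he.ne' p)
  have hn0 : 0 < n := hn.pos
  have : Finite k := Nat.finite_of_card_ne_zero (by rw [hk]; positivity)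
  have : CharP k p := by
    have := Fintype.ofFinite k
    refine charP_of_card_eq_prime_pow (f := e * (2 * n)) ?_
    rw [← Nat.card_eq_fintype_card, hk, hq, ← pow_mul]
  generalize hm' : (q ^ n + 1) / (q + 1) = m at hyz
  have hmul : (q + 1) * m = q ^ n + 1 := by
    rw [← hm']
    have := Odd.nat_add_dvd_pow_add_pow q 1 hn
    rw [one_pow] at this
    exact Nat.mul_div_cancel' this
  have hm : 0 < m := Nat.pos_of_ne_zero (by rintro rfl; simp at hmul)
  have hqm : q.Coprime m := by
    have h1 : q.Coprime ((q + 1) * m) := by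
      rw [hmul]
      obtain ⟨j, rfl⟩ := Nat.exists_eq_succ_of_ne_zero hn0.ne'
      rw [Nat.succ_eq_add_one, pow_succ']
      simp
    exact h1.coprime_mul_left_right
  have hqk : (q : k) = 0 := by rw [hq, Nat.cast_pow, CharP.cast_eq_zero, zero_pow he.ne']
  have hmk : (m : k) = 1 := by
    have := congrArg (Nat.cast : ℕ → k) hmul
    push_cast at this
    rwa [hqk, zero_add, one_mul, zero_pow hn0.ne', zero_add] at this
  -- `m = 1` occurs for `n = 1`. For odd `n ≥ 3`, `(q + 1) * m = q ^ n + 1` exceeds `q ^ 3`, and `m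
  -- = q ^ 2 * t + 1` would give `q ^ 2 ∣ q`.
  have hm1 : m = 1 ∨ 2 ≤ m ∧ ¬ q ^ 2 ∣ m - 1 ∧ q ^ 3 < (q + 1) * m := by
    obtain ⟨j, rfl⟩ := hn
    rcases Nat.eq_zero_or_pos j with rfl | hj
    · left
      rw [mul_zero, zero_add, pow_one] at hmul
      exact Nat.eq_of_mul_eq_mul_left (Nat.succ_pos q) (by rw [hmul, mul_one])
    · right
      have h3 : q ^ 3 ≤ q ^ (2 * j + 1) := Nat.pow_le_pow_right (by omega) (by omega)
      have hm3 : q ^ 3 < (q + 1) * m := by omega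
      refine ⟨?_, ?_, hm3⟩
      · by_contra! h
        have : m = 1 := by omega
        subst this
        nlinarith [pow_succ q 2]
      · rintro ⟨t, ht⟩
        have h4 : m = q ^ 2 * t + 1 := by omega
        have h5 : q ^ 2 * ((q + 1) * t) + q = q ^ 2 * q ^ (2 * j - 1) := by
          rw [← pow_add, show 2 + (2 * j - 1) = 2 * j + 1 by omega]
          rw [h4] at hmul
          linarith
        have h6 : q ^ 2 ∣ q := (Nat.dvd_add_right (Dvd.intro _ rfl)).1
            (h5 ▸ Dvd.intro _ rfl : q ^ 2 ∣ q ^ 2 * ((q + 1) * t) + q)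
        have h7 := Nat.le_of_dvd (by omega) h6
        nlinarith
  have hkQ : ∀ d : k, algebraMap k C d ∈ Qinf := hQ.1.1
  have hyQ : y ∉ Qinf := fun hy => hQ.2
    (ValuationSubring.mem_of_pow_mem hm (hyz ▸ sub_mem (pow_mem hy _) hy))
  have hyk : ∀ d : k, y ≠ algebraMap k C d := fun d h => hyQ (h ▸ hkQ d)
  obtain ⟨a, b, c, ha0, ha, hb, hc, hgy, hgx⟩ := exists_affine_of_smul_eq he hq hm hqm hmk hm1 htop
    hxy hyz hkQ hyQ (MulAction.mem_stabilizer_iff.1 hg)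
  have hcq : c ^ q ^ 2 = c := by
    have h1 := pow_succ_pow_eq hb
    have hadd : (c ^ q + c) ^ q = (c ^ q) ^ q + c ^ q := by rw [hq, add_pow_char_pow]
    rw [← hc, hadd, ← pow_mul, ← sq] at h1
    linear_combination h1
  have haF := (mem_Fq2_iff hp hq).2 ha
  have hbF := (mem_Fq2_iff hp hq).2 hb
  have hcF := (mem_Fq2_iff hp hq).2 hcq
  obtain ⟨h, hgh⟩ := exists_isRestriction ha0 haF hbF hcF hgy hgx
  have hnum := numFixed_eq_encard_affineFixed he hq hm hqm htop hxy hyz hkQ hyQ ha0 hgy hgx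
  -- Around a fixed point the map is diagonal, so its powers are trivial exactly when those of `a`
  -- are.
  have hord : (affineFixed q a b c).Nonempty → orderOf h = orderOf a := fun hne =>
    orderOf_eq_orderOf_iff.2 fun N =>
      (hgh.pow_eq_one_iff N).trans (pow_fixes_iff_of_mem_affineFixed hq hyk hgy hgx hne N)
  have hnonempty : ¬ p ∣ orderOf h → (affineFixed q a b c).Nonempty := fun hdvd => by
    obtain ⟨h1, h2⟩ := (hgh.pow_eq_one_iff _).1 (pow_orderOf_eq_one h)
    exact affineFixed_nonempty_of_pow_fixes he hq hk ha hb ha0 hc hgy hgx hdvd h1 h2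
  have hne1 : (affineFixed q a b c).Nonempty → h ≠ 1 → a ≠ 1 := fun hne h1 ha1 =>
    h1 (orderOf_eq_one_iff.1 (by rw [hord hne, ha1, orderOf_one]))
  refine ⟨h, MulAction.mem_stabilizer_iff.2
    (smul_eq_of_isPoleOf_hermX hq2 hxy hP hgh haF hbF hgy), hgh, ?_, ?_, ?_, ?_⟩
  · intro hdvd
    rw [hnum, Set.encard_eq_zero, ← Set.not_nonempty_iff_eq_empty]
    intro hne
    rw [hord hne] at hdvd
    refine not_dvd_orderOf_of_pow_eq he hq ?_ hdvd
    apply mul_right_cancel₀ ha0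
    rw [← pow_succ, Nat.sub_add_cancel (Nat.one_le_pow _ _ (by omega)), ha, one_mul]
  · intro h1
    obtain ⟨hgx1, hgy1⟩ := hgh.eq_one_iff.1 h1
    have hne := hnonempty (by rw [h1, orderOf_one]; exact hp.not_dvd_one)
    have ha1 : a = 1 := orderOf_eq_one_iff.1 (by rw [← hord hne, h1, orderOf_one])
    subst ha1
    have hb0 : b = 0 := by
      rw [hgy1, map_one, one_mul, left_eq_add] at hgy
      exact (map_eq_zero _).1 hgy
    subst hb0
    have hc0 : c = 0 := by
      rw [hgx1, one_pow, map_one, one_mul, zero_pow (by omega), mul_zero, map_zero, zero_mul,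
        add_zero, left_eq_add] at hgx
      exact (map_eq_zero _).1 hgx
    subst hc0
    rw [hnum, encard_affineFixed_one he hq hk]
  · intro hdvd h1 hdvd1
    have hne := hnonempty hdvd
    rw [hnum, encard_affineFixed_of_pow_eq_one he hq hk (hne1 hne h1) ?_ hne]
    exact orderOf_dvd_iff_pow_eq_one.1 (hord hne ▸ hdvd1)
  · intro hdvd h1 hdvd1
    have hne := hnonempty hdvd
    rw [hnum, encard_affineFixed_of_pow_ne_one (hne1 hne h1) ?_ hne]
    exact fun h2 => hdvd1 (hord hne ▸ orderOf_dvd_iff_pow_eq_one.2 h2)
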